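/- Let $n\ge 2$, let $\mathfrak A_n$ be the noncommutative disc algebra, i.e. the norm-closed unital algebra generated by the left creation operators $S_1,\dots,S_n$ on the Fock space $\ell^2(\mathbb F_n^+)$, and let $\phi$ be an isometric automorphism of $\mathfrak A_n$. Let $\mathfrak A_n\times_\phi\mathbb Z^+$ be the semicrossed product, i.e. the universal operator algebra generated by $\mathfrak A_n$ and a contraction $U$ with $AU=U\phi(A)$ for $A\in\mathfrak A_n$; its norm is the supremum over all pairs $(\pi,K)$ of a unital completely contractive representation $\pi$ of $\mathfrak A_n$ on a Hilbert space and a contraction $K$ with $\pi(A)K=K\pi(\phi(A))$. Let $\mathfrak J_\phi$ be the closed two-sided ideal of $\mathfrak A_n\times_\phi\mathbb Z^+$ generated by $U$. For $z$ in the open unit ball $\mathbb B_n$ of $\mathbb C^n$ let $\theta_z$ be the character of $\mathfrak A_n$ with $\theta_z(S_i)=z_i$ for all $i$, and let $\theta_{z,0}$ be the character of $\mathfrak A_n\times_\phi\mathbb Z^+$ that extends $\theta_z$ and vanishes at $U$. Put $\hat\phi(\theta)=\theta\circ\phi$ for characters $\theta$ of $\mathfrak A_n$. For $Z'=(z'_1,\dots,z'_l)\in\mathbb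 B_n^l$ let $\mathcal N_{Z',l}$ be the set of bounded representations $\rho$ of $\mathfrak A_n\times_\phi\mathbb Z^+$ onto the algebra of upper triangular $l\times l$ matrices whose $i$-th diagonal entry is the character $\theta_{z'_i,0}$ for $1\le i\le l$. For a sequence $Z=(z_1,z_2,\dots)$ in $\mathbb B_n$ put $d(Z',Z)=\max_{1\le i\le l}\|z'_i-z_i\|$ and $$\mathfrak I_Z:=\bigcap_{l\ge 2}\ \bigcup_{\varepsilon>0}\ \bigcap\{\ker\rho:\ \rho\in\mathcal N_{Z',l},\ Z'\in\mathbb B_n^l,\ d(Z',Z)<\varepsilon\}.$$ Then: 1. $\mathfrak I_Z\subseteq\mathfrak J_\phi$ for every sequence $Z$ in $\mathbb B_n$; 2. $\mathfrak I_Z=\mathfrak J_\phi$ whenever $\hat\phi(Z)\cap Z=\varnothing$, that is, whenever $\theta_{z_i}\circ\phi\ne\theta_{z_j}$ for all $i,j$; 3. $\mathfrak J_\phi=\bigcup_Z\mathfrak I_Z$, the union over all sequences $Z$ in $\mathbb B_n$. -/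

import Mathlib

open scoped ENNReal lp

noncomputable section

namespace NCDisc

/-! ### The noncommutative disc algebra -/

/-- Full Fock space `ℓ²(𝔽ₙ⁺)`, where `𝔽ₙ⁺` is the free semigroup (with unit) on `n` letters. -/
abbrev Fock (n : ℕ) : Type := lp (fun _ : FreeMonoid (Fin n) => ℂ) 2

open Classical in
/-- The canonical basis vector `ξ_w` of Fock space. -/
def ξ {n : ℕ} (w : FreeMonoid (Fin n)) : Fock n := lp.single 2 w (1 : ℂ)

theorem orthonormal_ξ_mul {n : ℕ} (i : Fin n) :
    Orthonormal ℂ (fun w : FreeMonoid (Fin n) => ξ (FreeMonoid.of i * w)) := by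
  classical
  rw [orthonormal_iff_ite]
  intro v w
  unfold ξ
  rw [lp.inner_single_left, lp.single_apply]
  by_cases h : v = w
  · subst h; simp
  · have h2 : FreeMonoid.of i * v ≠ FreeMonoid.of i * w := fun e => h (mul_left_cancel e)
    simp [h, h2]

/-- The left creation operator `Sᵢ = λ(i)`, i.e. the isometry with `Sᵢ ξ_w = ξ_{iw}`. -/
def creation {n : ℕ} (i : Fin n) : Fock n →L[ℂ] Fock n :=
  (orthonormal_ξ_mul i).orthogonalFamily.linearIsometry.toContinuousLinearMap

theorem creation_ξ {n : ℕ} (i : Fin n) (w : FreeMonoid (Fin n)) :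
    creation i (ξ w) = ξ (FreeMonoid.of i * w) := by
  classical
  have h := (orthonormal_ξ_mul i).orthogonalFamily.linearIsometry_apply_single (i := w) (1 : ℂ)
  simp only [LinearIsometry.toSpanSingleton_apply, one_smul] at h
  rw [← h]
  unfold creation ξ
  simp only [LinearIsometry.coe_toContinuousLinearMap]

/-- The noncommutative disc algebra `𝔄ₙ`: the norm-closed unital algebra generated by
`S₁, …, Sₙ` on Fock space. -/
def discSubalgebra (n : ℕ) : Subalgebra ℂ (Fock n →L[ℂ] Fock n) :=
  (Algebra.adjoin ℂ (Set.range (creation (n := n)))).topologicalClosure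

/-- The noncommutative disc algebra as a type. -/
abbrev Disc (n : ℕ) : Type := discSubalgebra n

/-- The generator `Sᵢ` as an element of `𝔄ₙ`. -/
def S {n : ℕ} (i : Fin n) : Disc n :=
  ⟨creation i, Subalgebra.le_topologicalClosure _ (Algebra.subset_adjoin ⟨i, rfl⟩)⟩

/-! ### Completely contractive representations -/

/-- A matrix of operators on `E`, acting on the Hilbert space direct sum `E ⊕ ⋯ ⊕ E`. -/
def opMatrix {E : Type*} [NormedAddCommGroup E] [InnerProductSpace ℂ E] {m : ℕ}
    (T : Matrix (Fin m) (Fin m) (E →L[ℂ] E)) :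
    PiLp 2 (fun _ : Fin m => E) →L[ℂ] PiLp 2 (fun _ : Fin m => E) :=
  (PiLp.continuousLinearEquiv 2 ℂ (fun _ : Fin m => E)).symm.toContinuousLinearMap ∘L
    (ContinuousLinearMap.pi fun i => ∑ j, T i j ∘L ContinuousLinearMap.proj j) ∘L
    (PiLp.continuousLinearEquiv 2 ℂ (fun _ : Fin m => E)).toContinuousLinearMap

theorem opMatrix_apply {E : Type*} [NormedAddCommGroup E] [InnerProductSpace ℂ E] {m : ℕ}
    (T : Matrix (Fin m) (Fin m) (E →L[ℂ] E)) (x : PiLp 2 (fun _ : Fin m => E)) (i : Fin m) :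
    opMatrix T x i = ∑ j, T i j (x j) := by
  simp [opMatrix]

/-- A unital homomorphism `π : 𝔄ₙ → B(H)` is completely contractive if all its matrix
amplifications are contractive. -/
def CompletelyContractive {n : ℕ} {H : Type*} [NormedAddCommGroup H] [InnerProductSpace ℂ H]
    (π : Disc n →ₐ[ℂ] (H →L[ℂ] H)) : Prop :=
  ∀ (m : ℕ) (a : Matrix (Fin m) (Fin m) (Disc n)),
    ‖opMatrix (a.map fun x => π x)‖ ≤ ‖opMatrix (a.map fun x => (x : Fock n →L[ℂ] Fock n))‖

theorem norm_opMatrix_one {E : Type*} [NormedAddCommGroup E] [InnerProductSpace ℂ E]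
    (T : Matrix (Fin 1) (Fin 1) (E →L[ℂ] E)) : ‖opMatrix T‖ = ‖T 0 0‖ := by
  have key : ∀ x : PiLp 2 (fun _ : Fin 1 => E), ‖x‖ = ‖x 0‖ := fun x => by
    simp [PiLp.norm_eq_of_L2, Real.sqrt_sq (norm_nonneg _)]
  apply le_antisymm
  · refine ContinuousLinearMap.opNorm_le_bound _ (norm_nonneg _) fun x => ?_
    rw [key, key x, opMatrix_apply]
    simpa using (T 0 0).le_opNorm (x 0)
  · refine ContinuousLinearMap.opNorm_le_bound _ (norm_nonneg (opMatrix T)) fun x => ?_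
    have h := (opMatrix T).le_opNorm (WithLp.toLp 2 fun _ => x)
    rw [key, key (WithLp.toLp 2 fun _ => x), opMatrix_apply] at h
    simpa using h

theorem CompletelyContractive.norm_le {n : ℕ} {H : Type*} [NormedAddCommGroup H]
    [InnerProductSpace ℂ H] {π : Disc n →ₐ[ℂ] (H →L[ℂ] H)} (h : CompletelyContractive π)
    (a : Disc n) : ‖π a‖ ≤ ‖a‖ := by
  have := h 1 (fun _ _ => a)
  rw [norm_opMatrix_one, norm_opMatrix_one] at this
  exact this

/-! ### The semicrossed product -/

/-- A covariant pair for `(𝔄ₙ, φ)`: a completely contractive representation `π` of `𝔄ₙ` on a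
Hilbert space `H ≠ 0` and a contraction `K` on `H` with `π(A) K = K π(φ(A))`. Since `𝔄ₙ` is
separable, Hilbert spaces in `Type` suffice for the universal norm. -/
structure CovariantPair {n : ℕ} (φ : Disc n ≃ₐ[ℂ] Disc n) where
  H : Type
  [normedAddCommGroup : NormedAddCommGroup H]
  [innerProductSpace : InnerProductSpace ℂ H]
  [completeSpace : CompleteSpace H]
  [nontrivial : Nontrivial H]
  π : Disc n →ₐ[ℂ] (H →L[ℂ] H)
  completelyContractive : CompletelyContractive π
  K : H →L[ℂ] H
  norm_K_le : ‖K‖ ≤ 1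
  covariant : ∀ A : Disc n, π A * K = K * π (φ A)

attribute [instance] CovariantPair.normedAddCommGroup CovariantPair.innerProductSpace
  CovariantPair.completeSpace CovariantPair.nontrivial

variable {n : ℕ}

/-- The C*-algebra `∏ B(H)` (bounded families), the product being over all covariant pairs. -/
abbrev BigAlgebra (φ : Disc n ≃ₐ[ℂ] Disc n) : Type 1 :=
  lp (fun P : CovariantPair φ => P.H →L[ℂ] P.H) ∞

/-- The universal representation `A ↦ (π(A))_{(π, K)}` of `𝔄ₙ`. -/
def univRep (φ : Disc n ≃ₐ[ℂ] Disc n) : Disc n →ₐ[ℂ] BigAlgebra φ where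
  toFun A := ⟨fun P => P.π A, memℓp_infty
    ⟨‖A‖, by rintro _ ⟨P, rfl⟩; exact P.completelyContractive.norm_le A⟩⟩
  map_one' := by ext P : 2; exact map_one P.π
  map_mul' A B := by ext P : 2; exact map_mul P.π A B
  map_zero' := by ext P : 2; exact map_zero P.π
  map_add' A B := by ext P : 2; exact map_add P.π A B
  commutes' c := by ext P : 2; exact P.π.commutes c

/-- The universal contraction `(K)_{(π, K)}`. -/
def univContraction (φ : Disc n ≃ₐ[ℂ] Disc n) : BigAlgebra φ :=
  ⟨fun P => P.K, memℓp_infty ⟨1, by rintro _ ⟨P, rfl⟩; exact P.norm_K_le⟩⟩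

/-- The semicrossed product `𝔄ₙ ×_φ ℤ⁺`: the norm-closed algebra generated by the universal
covariant pair. Its norm is the supremum over all covariant pairs. -/
def semicrossedSubalgebra (φ : Disc n ≃ₐ[ℂ] Disc n) : Subalgebra ℂ (BigAlgebra φ) :=
  (Algebra.adjoin ℂ (Set.range (univRep φ) ∪ {univContraction φ})).topologicalClosure

/-- The semicrossed product as a type. -/
def Semicrossed (φ : Disc n ≃ₐ[ℂ] Disc n) : Type 1 := semicrossedSubalgebra φ

instance (φ : Disc n ≃ₐ[ℂ] Disc n) : NormedRing (Semicrossed φ) :=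
  inferInstanceAs (NormedRing (semicrossedSubalgebra φ))

instance (φ : Disc n ≃ₐ[ℂ] Disc n) : NormedAlgebra ℂ (Semicrossed φ) :=
  inferInstanceAs (NormedAlgebra ℂ (semicrossedSubalgebra φ))

/-- The inclusion of `𝔄ₙ` into the semicrossed product. -/
def incl (φ : Disc n ≃ₐ[ℂ] Disc n) : Disc n →ₐ[ℂ] Semicrossed φ :=
  (univRep φ).codRestrict (semicrossedSubalgebra φ) fun A =>
    Subalgebra.le_topologicalClosure _ (Algebra.subset_adjoin (Or.inl ⟨A, rfl⟩))

/-- The canonical contraction `U` in the semicrossed product. -/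
def U (φ : Disc n ≃ₐ[ℂ] Disc n) : Semicrossed φ :=
  (⟨univContraction φ,
    Subalgebra.le_topologicalClosure _ (Algebra.subset_adjoin (Or.inr rfl))⟩ :
    semicrossedSubalgebra φ)

theorem incl_mul_U (φ : Disc n ≃ₐ[ℂ] Disc n) (A : Disc n) :
    incl φ A * U φ = U φ * incl φ (φ A) := by
  apply Subtype.ext
  show univRep φ A * univContraction φ = univContraction φ * univRep φ (φ A)
  ext P : 2
  exact P.covariant A

/-- `𝔍_φ`: the closed two-sided ideal generated by `U`. -/
def idealJ (φ : Disc n ≃ₐ[ℂ] Disc n) : TwoSidedIdeal (Semicrossed φ) :=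
  sInf {I | IsClosed (I : Set (Semicrossed φ)) ∧ U φ ∈ I}

/-! ### Characters -/

/-- The point `(θ(S₁), …, θ(Sₙ))` that corresponds to a character `θ` of `𝔄ₙ`
(a character of a Banach algebra is automatically continuous). -/
def charPoint (θ : Disc n →ₐ[ℂ] ℂ) : EuclideanSpace ℂ (Fin n) :=
  WithLp.toLp 2 fun i => θ (S i)

/-- The action `φ̂(θ) = θ ∘ φ` on characters of `𝔄ₙ`. -/
def hat (φ : Disc n ≃ₐ[ℂ] Disc n) (θ : Disc n →ₐ[ℂ] ℂ) : Disc n →ₐ[ℂ] ℂ :=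
  θ.comp φ.toAlgHom

/-- The pair `(z, t)`, with `z` the point of `θ` restricted to `𝔄ₙ` and `t = θ(U)`, that
corresponds to a character `θ` of the semicrossed product; `θ_{z,0}` is the character with
pair `(z, 0)`. -/
def semicrossedCharPoint {φ : Disc n ≃ₐ[ℂ] Disc n} (θ : Semicrossed φ →ₐ[ℂ] ℂ) :
    EuclideanSpace ℂ (Fin n) × ℂ :=
  (charPoint (θ.comp (incl φ)), θ (U φ))

/-- The open unit ball `𝔹ₙ` of `ℂⁿ`. -/
abbrev OpenBall (n : ℕ) : Type := Metric.ball (0 : EuclideanSpace ℂ (Fin n)) 1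

/-- The set of characters `θ_z` of `𝔄ₙ`, where `z` runs through the entries of the sequence. -/
def charSet (Z : ℕ → OpenBall n) : Set (Disc n →ₐ[ℂ] ℂ) :=
  {θ | ∃ i, charPoint θ = Z i}

/-! ### Nest representations -/

/-- A (bounded) representation of the semicrossed product onto the algebra `𝔗_l` of upper
triangular `l × l` matrices. -/
structure NestRep (φ : Disc n ≃ₐ[ℂ] Disc n) (l : ℕ) where
  toAlgHom : Semicrossed φ →ₐ[ℂ] Matrix (Fin l) (Fin l) ℂ
  continuous : Continuous toAlgHom
  range_eq : Set.range toAlgHom = {M | M.BlockTriangular id}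

theorem diag_mul_of_upper {l : ℕ} {M N : Matrix (Fin l) (Fin l) ℂ}
    (hM : M.BlockTriangular id) (hN : N.BlockTriangular id) (i : Fin l) :
    (M * N) i i = M i i * N i i := by
  rw [Matrix.mul_apply, Finset.sum_eq_single i]
  · intro j _ hj
    rcases lt_or_gt_of_ne hj with h | h
    · rw [hM h, zero_mul]
    · rw [hN h, mul_zero]
  · simp

/-- The diagonal character `θ_{ρ,i}(A) = ⟨ρ(A) ξᵢ, ξᵢ⟩`. -/
def NestRep.diagChar {φ : Disc n ≃ₐ[ℂ] Disc n} {l : ℕ} (ρ : NestRep φ l) (i : Fin l) :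
    Semicrossed φ →ₐ[ℂ] ℂ where
  toFun X := ρ.toAlgHom X i i
  map_one' := by simp
  map_mul' X Y := by
    have h : ∀ X, (ρ.toAlgHom X).BlockTriangular id := fun X => by
      have hX : ρ.toAlgHom X ∈ Set.range ρ.toAlgHom := ⟨X, rfl⟩
      rw [ρ.range_eq] at hX
      exact hX
    rw [map_mul, diag_mul_of_upper (h X) (h Y)]
  map_zero' := by simp
  map_add' X Y := by simp
  commutes' c := by rw [AlgHom.commutes, Matrix.algebraMap_matrix_apply, if_pos rfl]

/-- `𝒩_{Z',l}`: the nest representations onto `𝔗_l` with diagonal characters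
`θ_{z'₁,0}, …, θ_{z'_l,0}`. -/
def nestFamily (φ : Disc n ≃ₐ[ℂ] Disc n) {l : ℕ} (Z' : Fin l → OpenBall n) :
    Set (NestRep φ l) :=
  {ρ | ∀ i, semicrossedCharPoint (ρ.diagChar i) = ((Z' i : EuclideanSpace ℂ (Fin n)), 0)}

/-- `d(Z, Z') = sup {‖zᵢ - z'ᵢ‖ : 1 ≤ i ≤ l}` (entries are numbered from `0` here). -/
def seqDist {l : ℕ} (Z : ℕ → OpenBall n) (Z' : Fin l → OpenBall n) : ℝ :=
  ⨆ i : Fin l, ‖(Z i : EuclideanSpace ℂ (Fin n)) - Z' i‖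

/-- The kernel of a nest representation. -/
def NestRep.ker {φ : Disc n ≃ₐ[ℂ] Disc n} {l : ℕ} (ρ : NestRep φ l) :
    TwoSidedIdeal (Semicrossed φ) :=
  TwoSidedIdeal.ker ρ.toAlgHom

/-- The set `⋂_{l ≥ 2} ⋃_{ε > 0} ⋂ {ker ρ : ρ ∈ 𝒩_{Z',l}, Z' ∈ 𝔹ₙ^l, d(Z, Z') < ε}`. -/
def idealISet (φ : Disc n ≃ₐ[ℂ] Disc n) (Z : ℕ → OpenBall n) : Set (Semicrossed φ) :=
  ⋂ (l : ℕ) (_ : 2 ≤ l), ⋃ (ε : ℝ) (_ : 0 < ε),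
    ⋂ (Z' : Fin l → OpenBall n) (_ : seqDist Z Z' < ε) (ρ ∈ nestFamily φ Z'),
      (ρ.ker : Set (Semicrossed φ))

theorem mem_idealISet {φ : Disc n ≃ₐ[ℂ] Disc n} {Z : ℕ → OpenBall n} {X : Semicrossed φ} :
    X ∈ idealISet φ Z ↔ ∀ l : ℕ, 2 ≤ l → ∃ ε : ℝ, 0 < ε ∧ ∀ Z' : Fin l → OpenBall n,
      seqDist Z Z' < ε → ∀ ρ ∈ nestFamily φ Z', X ∈ ρ.ker := by
  simp [idealISet]

/-- The ideal `ℑ_Z` attached to the sequence `Z` in the open ball. -/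
def idealI (φ : Disc n ≃ₐ[ℂ] Disc n) (Z : ℕ → OpenBall n) : TwoSidedIdeal (Semicrossed φ) :=
  TwoSidedIdeal.mk' (idealISet φ Z)
    (mem_idealISet.2 fun _ _ => ⟨1, one_pos, fun _ _ ρ _ => ρ.ker.zero_mem⟩)
    (fun {X Y} hX hY => mem_idealISet.2 fun l hl => by
      obtain ⟨ε, hε, h⟩ := mem_idealISet.1 hX l hl
      obtain ⟨δ, hδ, h'⟩ := mem_idealISet.1 hY l hl
      exact ⟨min ε δ, lt_min hε hδ, fun Z' hZ ρ hρ => ρ.ker.add_mem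
        (h Z' (hZ.trans_le (min_le_left _ _)) ρ hρ)
        (h' Z' (hZ.trans_le (min_le_right _ _)) ρ hρ)⟩)
    (fun {X} hX => mem_idealISet.2 fun l hl => by
      obtain ⟨ε, hε, h⟩ := mem_idealISet.1 hX l hl
      exact ⟨ε, hε, fun Z' hZ ρ hρ => ρ.ker.neg_mem (h Z' hZ ρ hρ)⟩)
    (fun {X Y} hY => mem_idealISet.2 fun l hl => by
      obtain ⟨ε, hε, h⟩ := mem_idealISet.1 hY l hl
      exact ⟨ε, hε, fun Z' hZ ρ hρ => ρ.ker.mul_mem_left _ _ (h Z' hZ ρ hρ)⟩)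
    (fun {X Y} hX => mem_idealISet.2 fun l hl => by
      obtain ⟨ε, hε, h⟩ := mem_idealISet.1 hX l hl
      exact ⟨ε, hε, fun Z' hZ ρ hρ => ρ.ker.mul_mem_right _ _ (h Z' hZ ρ hρ)⟩)

theorem coe_idealI (φ : Disc n ≃ₐ[ℂ] Disc n) (Z : ℕ → OpenBall n) :
    (idealI φ Z : Set (Semicrossed φ)) = idealISet φ Z := by
  ext X
  exact TwoSidedIdeal.mem_mk' _ _ _ _ _ _ X

end NCDisc

end

/-!
# Nest representations and the ideal generated by `U`

`𝔍_φ` is the kernel of the homomorphism `constTerm φ` from the semicrossed product to `𝔄ₙ` that is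
the identity on `𝔄ₙ` and kills `U`; it is evaluation at the covariant pair `(id, 0)` on Fock space.

*Representations of `𝔄ₙ`.* Let `T` be an `n`-tuple in a Banach algebra `B`, and suppose that the
operator `transfer T : F ↦ (v ↦ ∑ₐ Tₐ F(Sₐ* v))` has norm less than one. The fixed point equation
`F = ⟨·, ξ_∅⟩ 1 + transfer T F` then has a solution `F = symbolMap T`, which satisfies
`F(ξ_∅) = 1` and `F(Sₐ v) = Tₐ F(v)`. Hence `A ↦ F(A ξ_∅)` is a bounded representation of `𝔄ₙ` with
`Sₐ ↦ Tₐ` (`discRep`), and it depends analytically on `T`. With `B = ℂ` this gives the characters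
`θ_z`, with `B` a matrix algebra the nest representations.

*`ℑ_Z ⊆ 𝔍_φ`* (`idealI_le_idealJ`). Let `X ∈ ℑ_Z`, let `A = constTerm φ X`, and let `u` be a nonempty
word of length `L`. Take tuples `T(t)` of upper triangular matrices of size `L + 1` with diagonal
`t y`, where `y` is a small perturbation of `Z`, and with a small multiple of the shift along `u` on
the superdiagonal. For generic `y` and `t ≠ 0` these generate all upper triangular matrices, because
`n ≥ 2` (`mem_of_bidiagonal_mem`), so for `t` near `1` they give nest representations with diagonal
near `Z` that vanish at `U`; by the choice of `X` they send `A` to `0`. By the identity theorem `A`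
goes to `0` at `t = 0` too, where the corner entry is a nonzero multiple of the coefficient of
`A ξ_∅` at `u`, and the diagonal entries are its coefficient at the empty word. So
`A ξ_∅ = 0`, and since `ℑ_Z` is an ideal, `A = 0`.

*`𝔍_φ ⊆ ℑ_Z` if `φ̂(z_j) ≠ z_i` for all `i < j`* (`idealJ_le_idealI`). This inequality persists for
diagonals near `Z`. If a nest representation `ρ` with such a diagonal did not annihilate `U`, then an
entry of the strictly upper triangular `ρ(U)` closest to the diagonal would, by the covariance
relation, identify `θ_{z_i}` with `φ̂(θ_{z_j})` for some `i < j`. A sequence of this kind always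
exists (`exists_seq_charPoint_hat_ne`): constant if `φ̂` moves a point of the ball, and otherwise
any sequence of distinct points.
-/

noncomputable section

-- Instance search on `(Fock n →L[ℂ] B) →L[ℂ] (Fock n →L[ℂ] B)` fails at the default depth.
set_option maxSynthPendingDepth 3

namespace NCDisc

variable {n : ℕ}

/-! ### Creation operators and their adjoints -/

theorem ξ_apply (v w : FreeMonoid (Fin n)) [Decidable (w = v)] :
    (ξ v : Fock n) w = if w = v then 1 else 0 := by
  classical
  unfold ξ
  rw [lp.single_apply]
  by_cases h : w = v
  · subst h; simp
  · simp [h]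

/-- Continuous linear maps on Fock space are determined by their values on the basis `ξ_w`. -/
theorem clm_ext_ξ {E : Type*} [NormedAddCommGroup E] [NormedSpace ℂ E] {f g : Fock n →L[ℂ] E}
    (h : ∀ w, f (ξ w) = g (ξ w)) : f = g := by
  classical
  refine lp.ext_continuousLinearMap (by simp) fun w => ?_
  ext
  simpa [ξ] using h w

theorem inner_ξ_left (w : FreeMonoid (Fin n)) (v : Fock n) : inner ℂ (ξ w) v = v w := by
  classical
  unfold ξ
  rw [lp.inner_single_left]
  simp

/-- The annihilation operator `Sₐ*`. -/
def annihilation (a : Fin n) : Fock n →L[ℂ] Fock n := (creation a).adjoint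

theorem annihilation_apply (a : Fin n) (v : Fock n) (w : FreeMonoid (Fin n)) :
    annihilation a v w = v (FreeMonoid.of a * w) := by
  rw [← inner_ξ_left, annihilation, ContinuousLinearMap.adjoint_inner_right, creation_ξ,
    inner_ξ_left]

theorem annihilation_ξ_one (a : Fin n) : annihilation a (ξ 1) = 0 := by
  classical
  ext w
  rw [annihilation_apply, ξ_apply, if_neg]
  · rfl
  · exact fun h => List.cons_ne_nil a _ h

theorem annihilation_creation_self (a : Fin n) (v : Fock n) :
    annihilation a (creation a v) = v := by
  classical
  have h : annihilation a ∘L creation a = ContinuousLinearMap.id ℂ _ := by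
    refine clm_ext_ξ fun w => ?_
    ext u
    have : FreeMonoid.of a * u = FreeMonoid.of a * w ↔ u = w :=
      ⟨fun h => mul_left_cancel h, fun h => h ▸ rfl⟩
    simp [annihilation_apply, creation_ξ, ξ_apply, this]
  exact congrArg (fun f => f v) h

theorem annihilation_creation_of_ne {a b : Fin n} (hab : a ≠ b) (v : Fock n) :
    annihilation a (creation b v) = 0 := by
  classical
  have h : annihilation a ∘L creation b = 0 := by
    refine clm_ext_ξ fun w => ?_
    ext u
    have : FreeMonoid.of a * u ≠ FreeMonoid.of b * w := fun h =>
      hab (List.cons.inj h).1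
    simp [annihilation_apply, creation_ξ, ξ_apply, this]
  exact congrArg (fun f => f v) h

theorem annihilation_creation (a b : Fin n) (v : Fock n) :
    annihilation a (creation b v) = if a = b then v else 0 := by
  split_ifs with h
  · rw [h, annihilation_creation_self]
  · exact annihilation_creation_of_ne h v

/-- The ranges of the `Sₐ` are mutually orthogonal: `∑ Sₐ Sₐ* ≤ 1`. -/
theorem sum_norm_annihilation_sq_le (v : Fock n) :
    ∑ a, ‖annihilation a v‖ ^ 2 ≤ ‖v‖ ^ 2 := by
  set u : Fock n := ∑ a, creation a (annihilation a v) with hu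
  have h1 : inner ℂ u v = ((∑ a, ‖annihilation a v‖ ^ 2 : ℝ) : ℂ) := by
    rw [hu, sum_inner, Complex.ofReal_sum]
    refine Finset.sum_congr rfl fun a _ => ?_
    rw [← ContinuousLinearMap.adjoint_inner_right]
    change inner ℂ (annihilation a v) (annihilation a v) = _
    rw [inner_self_eq_norm_sq_to_K]
    simp
  have h2 : inner ℂ u u = ((∑ a, ‖annihilation a v‖ ^ 2 : ℝ) : ℂ) := by
    conv_lhs => rw [hu, sum_inner]
    rw [Complex.ofReal_sum]
    refine Finset.sum_congr rfl fun a _ => ?_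
    rw [← ContinuousLinearMap.adjoint_inner_right]
    change inner ℂ (annihilation a v) (annihilation a u) = _
    have : annihilation a u = annihilation a v := by
      rw [hu, map_sum]
      simp [annihilation_creation]
    rw [this, inner_self_eq_norm_sq_to_K]
    simp
  set s : ℝ := ∑ a, ‖annihilation a v‖ ^ 2 with hs
  have hs0 : 0 ≤ s := Finset.sum_nonneg fun _ _ => sq_nonneg _
  have h3 : ‖u‖ ^ 2 = s := by
    rw [inner_self_eq_norm_sq_to_K] at h2
    exact Complex.ofReal_injective (by simpa using h2)
  have h4 : s ≤ ‖u‖ * ‖v‖ := by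
    have := norm_inner_le_norm (𝕜 := ℂ) u v
    rwa [h1, Complex.norm_real, Real.norm_of_nonneg hs0] at this
  nlinarith [sq_nonneg (‖u‖ - ‖v‖)]

/-! ### Representations given by strict row contractions -/

section Transfer

variable {B : Type*} [NormedRing B] [NormedAlgebra ℂ B]

/-- For a tuple `T` in a Banach algebra `B`, the operator `F ↦ (v ↦ ∑ₐ Tₐ F(Sₐ* v))` on bounded
linear maps `F` from Fock space to `B`. -/
def transfer (T : Fin n → B) : (Fock n →L[ℂ] B) →L[ℂ] (Fock n →L[ℂ] B) :=
  ∑ a, ContinuousLinearMap.compL ℂ (Fock n) B B (ContinuousLinearMap.mul ℂ B (T a)) ∘L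
      (ContinuousLinearMap.compL ℂ (Fock n) (Fock n) B).flip (annihilation a)

theorem transfer_apply (T : Fin n → B) (F : Fock n →L[ℂ] B) (v : Fock n) :
    transfer T F v = ∑ a, T a * F (annihilation a v) := by
  simp [transfer]

theorem transfer_add (T T' : Fin n → B) : transfer (T + T') = transfer T + transfer T' := by
  ext F v
  simp [transfer_apply, add_mul, Finset.sum_add_distrib]

theorem transfer_smul (c : ℂ) (T : Fin n → B) : transfer (c • T) = c • transfer T := by
  ext F v
  simp [transfer_apply, Finset.smul_sum]

theorem continuous_transfer :
    Continuous (transfer : (Fin n → B) → (Fock n →L[ℂ] B) →L[ℂ] (Fock n →L[ℂ] B)) := by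
  refine continuous_finsetSum _ fun a _ => ?_
  fun_prop

theorem norm_transfer_le {T : Fin n → B} {r : ℝ} (hr : 0 ≤ r)
    (h : ∀ x : Fin n → B, ‖∑ a, T a * x a‖ ≤ r * √(∑ a, ‖x a‖ ^ 2)) : ‖transfer T‖ ≤ r := by
  refine ContinuousLinearMap.opNorm_le_bound _ hr fun F => ?_
  refine ContinuousLinearMap.opNorm_le_bound _ (by positivity) fun v => ?_
  rw [transfer_apply, mul_assoc]
  refine (h _).trans (mul_le_mul_of_nonneg_left ?_ hr)
  refine Real.sqrt_le_iff.2 ⟨by positivity, ?_⟩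
  calc ∑ a, ‖F (annihilation a v)‖ ^ 2 ≤ ∑ a, (‖F‖ * ‖annihilation a v‖) ^ 2 :=
        Finset.sum_le_sum fun a _ => by gcongr; exact F.le_opNorm _
    _ = ‖F‖ ^ 2 * ∑ a, ‖annihilation a v‖ ^ 2 := by simp_rw [mul_pow, Finset.mul_sum]
    _ ≤ ‖F‖ ^ 2 * ‖v‖ ^ 2 := by gcongr; exact sum_norm_annihilation_sq_le v
    _ = (‖F‖ * ‖v‖) ^ 2 := by ring

/-- The map `v ↦ ⟨v, ξ_∅⟩ 1`. -/
def vacuumMap : Fock n →L[ℂ] B := (innerSL ℂ (ξ (1 : FreeMonoid (Fin n)))).smulRight (1 : B)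

theorem vacuumMap_apply (v : Fock n) : (vacuumMap v : B) = v 1 • (1 : B) := by
  simp [vacuumMap, inner_ξ_left]

/-- The bounded linear map from Fock space to `B` with `ξ_w ↦ T_w`, obtained from a Neumann
series; it is meaningful when `‖transfer T‖ < 1`. -/
def symbolMap (T : Fin n → B) : Fock n →L[ℂ] B :=
  Ring.inverse (1 - transfer T) vacuumMap

variable [CompleteSpace B] {T : Fin n → B}

theorem isUnit_one_sub_transfer (hT : ‖transfer T‖ < 1) : IsUnit (1 - transfer T) :=
  isUnit_one_sub_of_norm_lt_one (R := (Fock n →L[ℂ] B) →L[ℂ] (Fock n →L[ℂ] B)) hT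

/-- `symbolMap T` depends analytically on `T`. -/
theorem differentiableAt_symbolMap {T : ℂ → Fin n → B} {t : ℂ}
    (hd : DifferentiableAt ℂ (fun t => transfer (T t)) t) (hT : ‖transfer (T t)‖ < 1)
    (v : Fock n) : DifferentiableAt ℂ (fun t => symbolMap (T t) v) t := by
  have hi : DifferentiableAt ℂ (fun t => Ring.inverse (1 - transfer (T t))) t :=
    ((differentiableAt_const _).sub hd).inverse (isUnit_one_sub_transfer hT)
  exact (hi.clm_apply (differentiableAt_const _)).clm_apply (differentiableAt_const _)

theorem symbolMap_eq (hT : ‖transfer T‖ < 1) :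
    symbolMap T = vacuumMap + transfer T (symbolMap T) := by
  have h := Ring.mul_inverse_cancel _ (isUnit_one_sub_transfer hT)
  have h' := congrArg (fun L => L vacuumMap) h
  simp only [mul_apply_eq_comp, sub_apply,
    one_apply_eq_self] at h'
  exact eq_add_of_sub_eq h'

theorem symbolMap_ξ_one (hT : ‖transfer T‖ < 1) : symbolMap T (ξ 1) = 1 := by
  classical
  rw [symbolMap_eq hT, add_apply, vacuumMap_apply, transfer_apply]
  simp [annihilation_ξ_one, ξ_apply]

theorem symbolMap_creation (hT : ‖transfer T‖ < 1) (a : Fin n) (v : Fock n) :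
    symbolMap T (creation a v) = T a * symbolMap T v := by
  conv_lhs => rw [symbolMap_eq hT]
  have h0 : creation a v 1 = 0 := by
    rw [← inner_ξ_left, ← ContinuousLinearMap.adjoint_inner_left]
    change inner ℂ (annihilation a (ξ 1)) v = 0
    rw [annihilation_ξ_one, inner_zero_left]
  rw [add_apply, vacuumMap_apply, transfer_apply, h0,
    Finset.sum_eq_single a (fun b _ hb => by rw [annihilation_creation_of_ne hb]; simp)
      (by simp), annihilation_creation_self]
  simp

theorem symbolMap_ξ (hT : ‖transfer T‖ < 1) (w : FreeMonoid (Fin n)) :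
    symbolMap T (ξ w) = FreeMonoid.lift T w := by
  induction w using FreeMonoid.inductionOn' with
  | one => rw [symbolMap_ξ_one hT, map_one]
  | of_mul a w ih => rw [← creation_ξ, symbolMap_creation hT, ih, map_mul, FreeMonoid.lift_eval_of]

theorem symbolMap_disc (hT : ‖transfer T‖ < 1) (A : Disc n) (v : Fock n) :
    symbolMap T ((A : Fock n →L[ℂ] Fock n) v) =
      symbolMap T ((A : Fock n →L[ℂ] Fock n) (ξ 1)) * symbolMap T v := by
  let E : Subalgebra ℂ (Fock n →L[ℂ] Fock n) :=
    { carrier := {A | ∀ v, symbolMap T (A v) = symbolMap T (A (ξ 1)) * symbolMap T v}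
      mul_mem' := fun {A C} hA hC v => by
        simp only [mul_apply_eq_comp]
        rw [hA, hC, hA (C (ξ 1)), mul_assoc]
      add_mem' := fun {A C} hA hC v => by
        simp only [add_apply, map_add]
        rw [hA, hC, add_mul]
      algebraMap_mem' := fun c v => by
        simp [ContinuousLinearMap.algebraMap_apply, symbolMap_ξ_one hT] }
  have hE : IsClosed (E : Set (Fock n →L[ℂ] Fock n)) := by
    have : (E : Set (Fock n →L[ℂ] Fock n)) =
        ⋂ v, {A | symbolMap T (A v) = symbolMap T (A (ξ 1)) * symbolMap T v} := by
      ext A; simp [E]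
    rw [this]
    exact isClosed_iInter fun v => isClosed_eq (by fun_prop) (by fun_prop)
  have hle : discSubalgebra n ≤ E := by
    refine Subalgebra.topologicalClosure_minimal (Algebra.adjoin_le ?_) hE
    rintro _ ⟨a, rfl⟩ v
    simp [symbolMap_creation hT, symbolMap_ξ_one hT]
  exact hle A.2 v

/-- The bounded representation of `𝔄ₙ` with `Sₐ ↦ Tₐ`. -/
def discRep (T : Fin n → B) (hT : ‖transfer T‖ < 1) : Disc n →ₐ[ℂ] B where
  toFun A := symbolMap T ((A : Fock n →L[ℂ] Fock n) (ξ 1))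
  map_one' := by simpa using symbolMap_ξ_one hT
  map_mul' A C := by
    rw [← symbolMap_disc hT A]
    rfl
  map_zero' := by simp
  map_add' A C := by simp
  commutes' c := by
    simp [Algebra.algebraMap_eq_smul_one, symbolMap_ξ_one hT]

theorem discRep_apply (hT : ‖transfer T‖ < 1) (A : Disc n) :
    discRep T hT A = symbolMap T ((A : Fock n →L[ℂ] Fock n) (ξ 1)) := rfl

theorem discRep_S (hT : ‖transfer T‖ < 1) (a : Fin n) : discRep T hT (S a) = T a := by
  rw [discRep_apply]
  change symbolMap T (creation a (ξ 1)) = _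
  rw [symbolMap_creation hT, symbolMap_ξ_one hT, mul_one]

theorem continuous_discRep (hT : ‖transfer T‖ < 1) : Continuous (discRep T hT) := by
  change Continuous fun A : Disc n => symbolMap T ((A : Fock n →L[ℂ] Fock n) (ξ 1))
  fun_prop

end Transfer

/-! ### Density arguments and characters -/

/-- A closed subalgebra of a topologically generated algebra that contains the generators is
everything. -/
theorem eq_top_of_isClosed_of_generators {A : Type*} [NormedRing A] [NormedAlgebra ℂ A]
    {s : Set A} {D : Subalgebra ℂ A} (hD : D = (Algebra.adjoin ℂ s).topologicalClosure)
    (E : Subalgebra ℂ D) (hE : IsClosed (E : Set D)) (hs : ∀ x : D, (x : A) ∈ s → x ∈ E) :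
    E = ⊤ := by
  subst hD
  have hcl : IsClosed ((E.map (Subalgebra.val _) : Subalgebra ℂ A) : Set A) := by
    rw [Subalgebra.coe_map]
    exact ((Subalgebra.isClosed_topologicalClosure _).isClosedEmbedding_subtypeVal.isClosedMap) _ hE
  have hle : (Algebra.adjoin ℂ s).topologicalClosure ≤ E.map (Subalgebra.val _) := by
    refine Subalgebra.topologicalClosure_minimal (Algebra.adjoin_le fun x hx => ?_) hcl
    exact ⟨⟨x, Subalgebra.le_topologicalClosure _ (Algebra.subset_adjoin hx)⟩, hs _ hx, rfl⟩
  refine eq_top_iff.2 fun x _ => ?_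
  obtain ⟨y, hy, hyx⟩ := hle x.2
  rwa [← Subtype.ext (show (y : A) = x from hyx)]

instance : CompleteSpace (Disc n) :=
  (Subalgebra.isClosed_topologicalClosure _).completeSpace_coe

/-- A character of `𝔄ₙ` is determined by its point: characters are automatically continuous. -/
theorem charPoint_injective : Function.Injective (charPoint (n := n)) := by
  intro θ θ' h
  have hc : ∀ θ : Disc n →ₐ[ℂ] ℂ, Continuous θ := fun θ => θ.toContinuousLinearMap.continuous
  have htop := eq_top_of_isClosed_of_generators (D := discSubalgebra n) rfl (AlgHom.equalizer θ θ')
    (isClosed_eq (hc θ) (hc θ')) (fun x hx => by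
      obtain ⟨a, ha⟩ := hx
      have hx : x = S a := @Subtype.ext _ _ x (S a) ha.symm
      rw [AlgHom.mem_equalizer, hx]
      exact congrArg (fun p : EuclideanSpace ℂ (Fin n) => p a) h)
  ext x
  exact htop.ge (Algebra.mem_top (x := x))

theorem norm_transfer_point_le (z : EuclideanSpace ℂ (Fin n)) :
    ‖transfer (B := ℂ) (fun a => z a)‖ ≤ ‖z‖ := by
  refine norm_transfer_le (norm_nonneg _) fun x => ?_
  rw [EuclideanSpace.norm_eq]
  refine (norm_sum_le _ _).trans ?_
  simp_rw [norm_mul]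
  exact Real.sum_mul_le_sqrt_mul_sqrt _ _ _

theorem norm_transfer_point_lt (z : OpenBall n) :
    ‖transfer (B := ℂ) (fun a => (z : EuclideanSpace ℂ (Fin n)) a)‖ < 1 :=
  (norm_transfer_point_le _).trans_lt (mem_ball_zero_iff.1 z.2)

/-- The character `θ_z` of `𝔄ₙ`. -/
def pointChar (z : OpenBall n) : Disc n →ₐ[ℂ] ℂ := discRep _ (norm_transfer_point_lt z)

theorem charPoint_pointChar (z : OpenBall n) : charPoint (pointChar z) = z := by
  ext a
  exact discRep_S (norm_transfer_point_lt z) a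

theorem eq_pointChar_iff {θ : Disc n →ₐ[ℂ] ℂ} {z : OpenBall n} :
    θ = pointChar z ↔ charPoint θ = z := by
  rw [← charPoint_pointChar z, charPoint_injective.eq_iff]

theorem continuous_pointChar_apply (A : Disc n) :
    Continuous fun z : OpenBall n => pointChar z A := by
  have h : Continuous fun z : OpenBall n =>
      symbolMap (B := ℂ) fun a => (z : EuclideanSpace ℂ (Fin n)) a := by
    refine continuous_iff_continuousAt.2 fun z => ?_
    have hu := isUnit_one_sub_transfer (norm_transfer_point_lt z)
    have hi : ContinuousAt (fun z : OpenBall n =>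
        Ring.inverse (1 - transfer (B := ℂ) fun a => (z : EuclideanSpace ℂ (Fin n)) a)) z := by
      refine ContinuousAt.comp (g := Ring.inverse) ?_ ?_
      · exact NormedRing.inverse_continuousAt
          (R := (Fock n →L[ℂ] ℂ) →L[ℂ] (Fock n →L[ℂ] ℂ)) hu.unit
      · refine (continuous_const.sub (continuous_transfer.comp ?_)).continuousAt
        fun_prop
    exact hi.clm_apply continuousAt_const
  exact h.clm_apply continuous_const

/-- The point of `φ̂(θ_z)` depends continuously on `z`. -/
theorem continuous_charPoint_hat (φ : Disc n ≃ₐ[ℂ] Disc n) :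
    Continuous fun z : OpenBall n => charPoint (hat φ (pointChar z)) := by
  refine (PiLp.continuous_toLp 2 _).comp (continuous_pi fun a => ?_)
  exact continuous_pointChar_apply (φ (S a))

/-! ### The quotient of the semicrossed product by `𝔍_φ` -/

instance nontrivial_fock : Nontrivial (Fock n) :=
  ⟨⟨ξ 1, 0, fun h => by
    classical
    have := congrArg (fun v : Fock n => v 1) h
    simp [ξ_apply] at this⟩⟩

/-- The covariant pair `(id, 0)` on Fock space. -/
def vacuumPair (φ : Disc n ≃ₐ[ℂ] Disc n) : CovariantPair φ where
  H := Fock n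
  π := (discSubalgebra n).val
  completelyContractive := fun _ _ => le_rfl
  K := 0
  norm_K_le := by simp
  covariant := fun A => by simp

/-- Evaluation of the product over all covariant pairs at the pair `(id, 0)`. -/
def evalVacuum (φ : Disc n ≃ₐ[ℂ] Disc n) : BigAlgebra φ →ₐ[ℂ] (Fock n →L[ℂ] Fock n) where
  toFun X := X (vacuumPair φ)
  map_one' := rfl
  map_mul' _ _ := rfl
  map_zero' := rfl
  map_add' _ _ := rfl
  commutes' _ := rfl

theorem continuous_evalVacuum (φ : Disc n ≃ₐ[ℂ] Disc n) : Continuous (evalVacuum φ) := by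
  refine AddMonoidHomClass.continuous_of_bound (evalVacuum φ) 1 fun X => ?_
  rw [one_mul]
  exact lp.norm_apply_le_norm ENNReal.top_ne_zero X (vacuumPair φ)

theorem evalVacuum_mem (φ : Disc n ≃ₐ[ℂ] Disc n) {X : BigAlgebra φ}
    (hX : X ∈ semicrossedSubalgebra φ) : evalVacuum φ X ∈ discSubalgebra n := by
  have hle : semicrossedSubalgebra φ ≤ (discSubalgebra n).comap (evalVacuum φ) := by
    refine Subalgebra.topologicalClosure_minimal (Algebra.adjoin_le ?_)
      ((Subalgebra.isClosed_topologicalClosure _).preimage (continuous_evalVacuum φ))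
    rintro _ (⟨A, rfl⟩ | rfl)
    · exact A.2
    · exact (discSubalgebra n).zero_mem
  exact hle hX

/-- The homomorphism `E₀` of the semicrossed product onto `𝔄ₙ` that is the identity on `𝔄ₙ` and
vanishes at `U`, i.e. the zeroth Fourier coefficient. -/
def constTerm (φ : Disc n ≃ₐ[ℂ] Disc n) : Semicrossed φ →ₐ[ℂ] Disc n :=
  ((evalVacuum φ).comp (semicrossedSubalgebra φ).val).codRestrict (discSubalgebra n)
    fun X => evalVacuum_mem φ X.2

theorem constTerm_incl (φ : Disc n ≃ₐ[ℂ] Disc n) (A : Disc n) : constTerm φ (incl φ A) = A := rfl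

theorem constTerm_U (φ : Disc n ≃ₐ[ℂ] Disc n) : constTerm φ (U φ) = 0 := rfl

theorem continuous_constTerm (φ : Disc n ≃ₐ[ℂ] Disc n) : Continuous (constTerm φ) :=
  ((continuous_evalVacuum φ).comp continuous_subtype_val).subtype_mk _

theorem norm_incl_le (φ : Disc n ≃ₐ[ℂ] Disc n) (A : Disc n) : ‖incl φ A‖ ≤ ‖A‖ :=
  lp.norm_le_of_forall_le (norm_nonneg A) fun P => P.completelyContractive.norm_le A

theorem continuous_incl (φ : Disc n ≃ₐ[ℂ] Disc n) : Continuous (incl φ) :=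
  AddMonoidHomClass.continuous_of_bound (incl φ) 1 fun A => by
    rw [one_mul]; exact norm_incl_le φ A

theorem isClosed_idealJ (φ : Disc n ≃ₐ[ℂ] Disc n) : IsClosed (idealJ φ : Set (Semicrossed φ)) := by
  have : (idealJ φ : Set (Semicrossed φ)) = ⋂ I ∈ {I : TwoSidedIdeal (Semicrossed φ) |
      IsClosed (I : Set (Semicrossed φ)) ∧ U φ ∈ I}, (I : Set (Semicrossed φ)) := by
    ext X
    simp [idealJ, TwoSidedIdeal.mem_sInf]
  rw [this]
  exact isClosed_biInter fun I hI => hI.1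

theorem U_mem_idealJ (φ : Disc n ≃ₐ[ℂ] Disc n) : U φ ∈ idealJ φ :=
  (TwoSidedIdeal.mem_sInf _).2 fun _ hI => hI.2

theorem idealJ_le {φ : Disc n ≃ₐ[ℂ] Disc n} {I : TwoSidedIdeal (Semicrossed φ)}
    (hI : IsClosed (I : Set (Semicrossed φ))) (hU : U φ ∈ I) : idealJ φ ≤ I :=
  sInf_le ⟨hI, hU⟩

theorem sub_incl_constTerm_mem (φ : Disc n ≃ₐ[ℂ] Disc n) (X : Semicrossed φ) :
    X - incl φ (constTerm φ X) ∈ idealJ φ := by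
  let E : Subalgebra ℂ (Semicrossed φ) :=
    { carrier := {X | X - incl φ (constTerm φ X) ∈ idealJ φ}
      mul_mem' := fun {X Y} hX hY => by
        have : X * Y - incl φ (constTerm φ (X * Y)) = (X - incl φ (constTerm φ X)) * Y +
            incl φ (constTerm φ X) * (Y - incl φ (constTerm φ Y)) := by
          simp only [map_mul]; noncomm_ring
        rw [Set.mem_ofPred_eq, this]
        exact (idealJ φ).add_mem ((idealJ φ).mul_mem_right _ _ hX)
          ((idealJ φ).mul_mem_left _ _ hY)
      add_mem' := fun {X Y} hX hY => by
        have : X + Y - incl φ (constTerm φ (X + Y)) = (X - incl φ (constTerm φ X)) +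
            (Y - incl φ (constTerm φ Y)) := by
          simp only [map_add]; abel
        rw [Set.mem_ofPred_eq, this]
        exact (idealJ φ).add_mem hX hY
      algebraMap_mem' := fun c => by
        simp only [Set.mem_ofPred_eq, AlgHom.commutes, sub_self]
        exact (idealJ φ).zero_mem }
  have hE : IsClosed (E : Set (Semicrossed φ)) :=
    (isClosed_idealJ φ).preimage
      (continuous_id.sub ((continuous_incl φ).comp (continuous_constTerm φ)))
  have htop : E = ⊤ := by
    refine eq_top_of_isClosed_of_generators (D := semicrossedSubalgebra φ) rfl E hE ?_
    rintro x (⟨A, hA⟩ | hx)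
    · obtain rfl : x = incl φ A := Subtype.ext hA.symm
      change incl φ A - incl φ (constTerm φ (incl φ A)) ∈ idealJ φ
      rw [ constTerm_incl, sub_self]
      exact (idealJ φ).zero_mem
    · obtain rfl : x = U φ := Subtype.ext hx
      change U φ - incl φ (constTerm φ (U φ)) ∈ idealJ φ
      rw [ constTerm_U, map_zero, sub_zero]
      exact U_mem_idealJ φ
  exact htop.ge (Algebra.mem_top (x := X))

/-- The kernel of the zeroth Fourier coefficient is contained in `𝔍_φ`. -/
theorem mem_idealJ_of_constTerm_eq_zero {φ : Disc n ≃ₐ[ℂ] Disc n} {X : Semicrossed φ}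
    (h : constTerm φ X = 0) : X ∈ idealJ φ := by
  have := sub_incl_constTerm_mem φ X
  rwa [h, map_zero, sub_zero] at this

/-! ### Nest representations that must annihilate `U` -/

theorem NestRep.blockTriangular {φ : Disc n ≃ₐ[ℂ] Disc n} {l : ℕ} (ρ : NestRep φ l)
    (X : Semicrossed φ) : (ρ.toAlgHom X).BlockTriangular id :=
  ρ.range_eq.subset ⟨X, rfl⟩

theorem NestRep.isClosed_ker {φ : Disc n ≃ₐ[ℂ] Disc n} {l : ℕ} (ρ : NestRep φ l) :
    IsClosed (ρ.ker : Set (Semicrossed φ)) := by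
  have : (ρ.ker : Set (Semicrossed φ)) = ρ.toAlgHom ⁻¹' {0} := by
    ext X
    exact TwoSidedIdeal.mem_ker _
  rw [this]
  exact isClosed_singleton.preimage ρ.continuous

theorem diagChar_comp_incl {φ : Disc n ≃ₐ[ℂ] Disc n} {l : ℕ} {Z' : Fin l → OpenBall n}
    {ρ : NestRep φ l} (hρ : ρ ∈ nestFamily φ Z') (i : Fin l) :
    (ρ.diagChar i).comp (incl φ) = pointChar (Z' i) :=
  eq_pointChar_iff.2 (congrArg Prod.fst (hρ i))

/-- If `φ̂(z'_j) ≠ z'_i` whenever `i < j`, then a nest representation with diagonal `Z'` kills `U`: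
a nonzero entry of the strictly upper triangular matrix `ρ(U)` as near to the diagonal as possible,
at `(i, j)` say, intertwines `θ_{z'_i}` and `φ̂(θ_{z'_j})`. -/
theorem NestRep.map_U_eq_zero {φ : Disc n ≃ₐ[ℂ] Disc n} {l : ℕ} {Z' : Fin l → OpenBall n}
    {ρ : NestRep φ l} (hρ : ρ ∈ nestFamily φ Z')
    (h : ∀ i j, i < j → charPoint (hat φ (pointChar (Z' j))) ≠ Z' i) : ρ.toAlgHom (U φ) = 0 := by
  have key : ∀ d : ℕ, ∀ i j : Fin l, (j : ℕ) = i + d → ρ.toAlgHom (U φ) i j = 0 := by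
    intro d
    induction d using Nat.strong_induction_on with
    | _ d ih =>
      intro i j hij
      rcases Nat.eq_zero_or_pos d with rfl | hd
      · obtain rfl : i = j := Fin.ext (by omega)
        exact congrArg Prod.snd (hρ i)
      by_contra hne
      refine h i j (Fin.lt_def.2 (by omega)) (eq_pointChar_iff.1 ?_)
      ext A
      have h0 : ∀ k m : Fin l, (m : ℕ) < k + d → ρ.toAlgHom (U φ) k m = 0 := fun k m hkm => by
        rcases lt_or_ge m k with hlt | hge
        · exact ρ.blockTriangular _ hlt
        · exact ih (m - k) (by omega) k m (by have := Fin.le_def.1 hge; omega)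
      have hA := congrArg (fun X => ρ.toAlgHom X i j) (incl_mul_U φ A)
      simp only [map_mul, Matrix.mul_apply] at hA
      rw [Finset.sum_eq_single i, Finset.sum_eq_single j] at hA
      · have h1 := congrArg (fun θ => θ A) (diagChar_comp_incl hρ i)
        have h2 := congrArg (fun θ => θ (φ A)) (diagChar_comp_incl hρ j)
        change ρ.toAlgHom (incl φ A) i i = _ at h1
        change ρ.toAlgHom (incl φ (φ A)) j j = _ at h2
        rw [h1, h2, mul_comm] at hA
        exact (mul_left_cancel₀ hne hA).symm
      · intro k _ hk
        rcases lt_or_gt_of_ne hk with hlt | hgt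
        · rw [h0 i k (by have := Fin.lt_def.1 hlt; omega), zero_mul]
        · rw [ρ.blockTriangular _ hgt, mul_zero]
      · simp
      · intro k _ hk
        rcases lt_or_gt_of_ne hk with hlt | hgt
        · rw [ρ.blockTriangular _ hlt, zero_mul]
        · rw [h0 k j (by have := Fin.lt_def.1 hgt; omega), mul_zero]
      · simp
  ext i j
  rcases lt_or_ge j i with hlt | hge
  · exact ρ.blockTriangular _ hlt
  · exact key (j - i) i j (by have := Fin.le_def.1 hge; omega)

theorem dist_lt_of_seqDist_lt {l : ℕ} {Z : ℕ → OpenBall n} {Z' : Fin l → OpenBall n} {ε : ℝ}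
    (hε : 0 < ε) (h : seqDist Z Z' < ε) : dist Z' (fun i => Z i) < ε := by
  refine (dist_pi_lt_iff hε).2 fun i => ?_
  rw [dist_comm, Subtype.dist_eq, dist_eq_norm]
  exact (le_ciSup (f := fun i : Fin l => ‖(Z i : EuclideanSpace ℂ (Fin n)) - Z' i‖)
    (Set.finite_range _).bddAbove i).trans_lt h

/-- The condition `φ̂(z_j) ≠ z_i` for `i < j` is open, so it forces all nest representations with
diagonal near `Z` to annihilate `U`. -/
theorem idealJ_le_idealI {φ : Disc n ≃ₐ[ℂ] Disc n} {Z : ℕ → OpenBall n}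
    (h : ∀ i j, i < j → charPoint (hat φ (pointChar (Z j))) ≠ Z i) : idealJ φ ≤ idealI φ Z := by
  intro X hX
  rw [← SetLike.mem_coe, coe_idealI]
  refine mem_idealISet.2 fun l _ => ?_
  have hopen : IsOpen {Z' : Fin l → OpenBall n |
      ∀ i j, i < j → charPoint (hat φ (pointChar (Z' j))) ≠ Z' i} := by
    simp only [Set.ofPred_forall]
    refine isOpen_iInter_of_finite fun i => isOpen_iInter_of_finite fun j =>
      isOpen_iInter_of_finite fun _ => isOpen_ne_fun ?_ ?_
    · exact (continuous_charPoint_hat φ).comp (continuous_apply j)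
    · fun_prop
  obtain ⟨ε, hε, hball⟩ := Metric.isOpen_iff.1 hopen (fun i => Z i)
    (fun i j hij => h i j (Fin.lt_def.1 hij))
  refine ⟨ε, hε, fun Z' hZ' ρ hρ => ?_⟩
  have hZ := hball (Metric.mem_ball.2 (dist_lt_of_seqDist_lt hε hZ'))
  exact idealJ_le ρ.isClosed_ker ((TwoSidedIdeal.mem_ker _).2 (ρ.map_U_eq_zero hρ hZ)) hX

/-- There is always a sequence with `φ̂(z_j) ≠ z_i` for `i < j`: a constant one if `φ̂` moves some
point of the ball, and any sequence of distinct points otherwise. -/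
theorem exists_seq_charPoint_hat_ne [Nonempty (Fin n)] (φ : Disc n ≃ₐ[ℂ] Disc n) :
    ∃ Z : ℕ → OpenBall n, ∀ i j, i < j → charPoint (hat φ (pointChar (Z j))) ≠ Z i := by
  by_cases h : ∃ z : OpenBall n, charPoint (hat φ (pointChar z)) ≠ z
  · obtain ⟨z, hz⟩ := h
    exact ⟨fun _ => z, fun _ _ _ => hz⟩
  · push Not at h
    have : Infinite (OpenBall n) := by
      have hinf : (Metric.ball (0 : EuclideanSpace ℂ (Fin n)) 1).Infinite :=
        infinite_of_mem_nhds 0 (Metric.ball_mem_nhds _ one_pos)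
      exact hinf.to_subtype
    refine ⟨Infinite.natEmbedding _, fun i j hij => ?_⟩
    rw [h]
    exact fun e => hij.ne' ((Infinite.natEmbedding (OpenBall n)).injective (Subtype.ext e))

/-! ### Generating the upper triangular matrices -/

/-- The `(i, i + p + q)` entry of a product of matrices vanishing below the `p`-th and the `q`-th
superdiagonal has only one term. -/
theorem band_mul_apply {l p q : ℕ} {M N : Matrix (Fin l) (Fin l) ℂ}
    (hM : ∀ i j : Fin l, (j : ℕ) < i + p → M i j = 0)
    (hN : ∀ i j : Fin l, (j : ℕ) < i + q → N i j = 0)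
    {i j k : Fin l} (hj : (j : ℕ) = i + p) (hk : (k : ℕ) = j + q) :
    (M * N) i k = M i j * N j k := by
  rw [Matrix.mul_apply, Finset.sum_eq_single j _ (by simp)]
  intro m _ hm
  rcases lt_or_gt_of_ne hm with h | h
  · rw [hM i m (by have := Fin.lt_def.1 h; omega), zero_mul]
  · rw [hN m k (by have := Fin.lt_def.1 h; omega), mul_zero]

theorem band_mul {l p q : ℕ} {M N : Matrix (Fin l) (Fin l) ℂ}
    (hM : ∀ i j : Fin l, (j : ℕ) < i + p → M i j = 0)
    (hN : ∀ i j : Fin l, (j : ℕ) < i + q → N i j = 0)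
    (i k : Fin l) (hk : (k : ℕ) < i + (p + q)) : (M * N) i k = 0 := by
  rw [Matrix.mul_apply]
  refine Finset.sum_eq_zero fun m _ => ?_
  rcases lt_or_ge (m : ℕ) (i + p) with h | h
  · rw [hM i m h, zero_mul]
  · rw [hN m k (by omega), mul_zero]

theorem blockTriangular_iff_band {l : ℕ} {M : Matrix (Fin l) (Fin l) ℂ} :
    M.BlockTriangular id ↔ ∀ i j : Fin l, (j : ℕ) < i + 0 → M i j = 0 :=
  Iff.rfl

/-- From an upper triangular matrix with distinct diagonal entries one obtains, by polynomial
calculus, an upper triangular matrix whose diagonal is that of a matrix unit. -/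
theorem exists_diag_eq_single {l : ℕ} {E : Subalgebra ℂ (Matrix (Fin l) (Fin l) ℂ)}
    {T : Matrix (Fin l) (Fin l) ℂ} (hTE : T ∈ E) (hT : T.BlockTriangular id)
    (hinj : Function.Injective fun i => T i i) (i : Fin l) :
    ∃ P ∈ E, P.BlockTriangular id ∧ ∀ j, P j j = if j = i then 1 else 0 := by
  have key : ∀ s : Finset (Fin l), i ∉ s →
      ∃ P ∈ E, P.BlockTriangular id ∧ P i i = 1 ∧ ∀ j ∈ s, P j j = 0 := by
    intro s
    induction s using Finset.induction_on with
    | empty => exact fun _ => ⟨1, E.one_mem, Matrix.blockTriangular_one, by simp, by simp⟩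
    | insert m s _ ih =>
      intro hi
      rw [Finset.mem_insert, not_or] at hi
      obtain ⟨P, hPE, hP, hPi, hPs⟩ := ih hi.2
      have hne : T i i - T m m ≠ 0 := sub_ne_zero.2 fun h => hi.1 (hinj h)
      set L : Matrix (Fin l) (Fin l) ℂ :=
        (T i i - T m m)⁻¹ • (T - algebraMap ℂ _ (T m m)) with hL
      have hLE : L ∈ E := E.smul_mem (E.sub_mem hTE (E.algebraMap_mem _)) _
      have hLd : ∀ j, L j j = (T i i - T m m)⁻¹ * (T j j - T m m) := fun j => by
        simp [hL, Matrix.algebraMap_matrix_apply]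
      have hLT : L.BlockTriangular id := fun j k hjk => by
        have : j ≠ k := ne_of_gt hjk
        simp [hL, Matrix.algebraMap_matrix_apply, this, hT hjk]
      refine ⟨P * L, E.mul_mem hPE hLE, hP.mul hLT, ?_, fun j hj => ?_⟩
      · rw [diag_mul_of_upper hP hLT, hPi, hLd, one_mul, inv_mul_cancel₀ hne]
      · rw [diag_mul_of_upper hP hLT]
        rcases Finset.mem_insert.1 hj with rfl | hj
        · simp [hLd]
        · rw [hPs j hj, zero_mul]
  obtain ⟨P, hPE, hP, hPi, hPs⟩ := key (Finset.univ.erase i) (by simp)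
  refine ⟨P, hPE, hP, fun j => ?_⟩
  split_ifs with h
  · rw [h, hPi]
  · exact hPs j (by simp [h])

/-- A subalgebra that contains an upper triangular matrix with distinct diagonal entries and, for
each `k`, a strictly upper triangular matrix with nonzero `(k, k + 1)` entry contains all upper
triangular matrices. -/
theorem mem_of_blockTriangular {l : ℕ} {E : Subalgebra ℂ (Matrix (Fin l) (Fin l) ℂ)}
    {T : Matrix (Fin l) (Fin l) ℂ} (hTE : T ∈ E) (hT : T.BlockTriangular id)
    (hinj : Function.Injective fun i => T i i)
    (hC : ∀ i j : Fin l, (j : ℕ) = i + 1 → ∃ C ∈ E,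
      (∀ a b : Fin l, (b : ℕ) < a + 1 → C a b = 0) ∧ C i j ≠ 0)
    {M : Matrix (Fin l) (Fin l) ℂ} (hM : M.BlockTriangular id) : M ∈ E := by
  -- Matrices on the `p`-th superdiagonal and above, unit on the superdiagonal itself.
  have unit : ∀ p : ℕ, ∀ i j : Fin l, (j : ℕ) = i + p → ∃ Y ∈ E,
      (∀ a b : Fin l, (b : ℕ) < a + p → Y a b = 0) ∧
      ∀ a b : Fin l, (b : ℕ) = a + p → Y a b = if a = i then 1 else 0 := by
    intro p
    induction p with
    | zero =>
      intro i j _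
      obtain ⟨P, hPE, hP, hPd⟩ := exists_diag_eq_single hTE hT hinj i
      refine ⟨P, hPE, blockTriangular_iff_band.1 hP, fun a b hab => ?_⟩
      obtain rfl : b = a := Fin.ext (by omega)
      exact hPd b
    | succ p ih =>
      intro i j hij
      have hjl := j.2
      obtain ⟨Y, hYE, hY, hYd⟩ := ih i ⟨i + p, by omega⟩ rfl
      obtain ⟨C, hCE, hCz, hCn⟩ := hC ⟨i + p, by omega⟩ j (by simp; omega)
      refine ⟨(C ⟨i + p, by omega⟩ j)⁻¹ • (Y * C), E.smul_mem (E.mul_mem hYE hCE) _,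
        fun a b hab => ?_, fun a b hab => ?_⟩
      · rw [Matrix.smul_apply, band_mul hY hCz a b hab, smul_zero]
      · have hbl := b.2
        rw [Matrix.smul_apply, band_mul_apply hY hCz (j := ⟨a + p, by omega⟩) rfl
          (by simp; omega), hYd _ _ rfl]
        split_ifs with h
        · subst h
          obtain rfl : b = j := Fin.ext (by omega)
          rw [one_mul, smul_eq_mul, inv_mul_cancel₀ hCn]
        · simp
  have main : ∀ d p : ℕ, p + d = l → ∀ M : Matrix (Fin l) (Fin l) ℂ,
      (∀ a b : Fin l, (b : ℕ) < a + p → M a b = 0) → M ∈ E := by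
    intro d
    induction d with
    | zero =>
      intro p hp M hM
      have : M = 0 := by
        ext a b
        exact hM a b (by have := b.2; omega)
      rw [this]
      exact E.zero_mem
    | succ d ih =>
      intro p hp M hM
      have hY : ∀ i : Fin l, ∃ Y ∈ E, (∀ a b : Fin l, (b : ℕ) < a + p → Y a b = 0) ∧
          ∀ a b : Fin l, (b : ℕ) = a + p → Y a b = if a = i then M a b else 0 := by
        intro i
        by_cases hi : (i : ℕ) + p < l
        · obtain ⟨Y, hYE, hY, hYd⟩ := unit p i ⟨i + p, hi⟩ rfl
          refine ⟨M i ⟨i + p, hi⟩ • Y, E.smul_mem hYE _, fun a b hab => ?_, fun a b hab => ?_⟩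
          · simp [hY a b hab]
          · rw [Matrix.smul_apply, hYd a b hab]
            split_ifs with h
            · subst h
              obtain rfl : b = ⟨a + p, hi⟩ := Fin.ext hab
              simp
            · simp
        · refine ⟨0, E.zero_mem, by simp, fun a b hab => ?_⟩
          have : a ≠ i := fun h => hi (by have := b.2; subst h; omega)
          simp [this]
      choose Y hYE hY hYd using hY
      have hsub := ih (p + 1) (by omega) (M - ∑ i, Y i) fun a b hab => by
        rw [Matrix.sub_apply, Matrix.sum_apply]
        rcases Nat.lt_or_ge (b : ℕ) (a + p) with h | h
        · rw [hM a b h, Finset.sum_eq_zero fun i _ => hY i a b h, sub_zero]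
        · simp [hYd _ a b (by omega)]
      have := E.add_mem hsub (E.sum_mem fun i (_ : i ∈ Finset.univ) => hYE i)
      rwa [sub_add_cancel] at this
  exact main l 0 (by omega) M (blockTriangular_iff_band.1 hM)

/-! ### Matrices along a word -/

open Classical in
/-- For a word `u` of length `L`, the shift matrices with `(i, j)` entry `1` if the `i`-th letter
of `u` is `a` and `j = i + 1`, and `0` otherwise; phrased through suffixes of `u`. -/
def wordShift (u : List (Fin n)) (a : Fin n) :
    Matrix (Fin (u.length + 1)) (Fin (u.length + 1)) ℂ :=
  fun i j => if u.drop i = a :: u.drop j then 1 else 0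

theorem wordShift_band (u : List (Fin n)) (a : Fin n) {i j : Fin (u.length + 1)}
    (h : (j : ℕ) ≠ i + 1) : wordShift u a i j = 0 := by
  refine if_neg fun e => h ?_
  have := congrArg List.length e
  simp only [List.length_drop, List.length_cons] at this
  have := i.2; have := j.2
  omega

theorem wordShift_get (u : List (Fin n)) {i j : Fin (u.length + 1)} (h : (j : ℕ) = i + 1)
    (hi : (i : ℕ) < u.length) (a : Fin n) :
    wordShift u a i j = if u[(i : ℕ)] = a then 1 else 0 := by
  classical
  refine if_congr ?_ rfl rfl
  rw [List.drop_eq_getElem_cons hi, h]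
  exact ⟨fun e => (List.cons.inj e).1, fun e => by rw [e]⟩

open Classical in
theorem lift_wordShift (u : List (Fin n)) (w : FreeMonoid (Fin n)) (i j : Fin (u.length + 1)) :
    FreeMonoid.lift (wordShift u) w i j =
      if u.drop i = FreeMonoid.toList w ++ u.drop j then 1 else 0 := by
  induction w using FreeMonoid.inductionOn' generalizing i with
  | one =>
    rw [map_one, Matrix.one_apply]
    refine if_congr ⟨fun h => by simp [h], fun h => Fin.ext ?_⟩ rfl rfl
    have := congrArg List.length h
    simp only [FreeMonoid.toList_one, List.nil_append, List.length_drop] at this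
    have := i.2; have := j.2
    omega
  | of_mul a w ih =>
    rw [map_mul, FreeMonoid.lift_eval_of, Matrix.mul_apply]
    simp only [FreeMonoid.toList_of_mul, List.cons_append]
    by_cases hi : (i : ℕ) < u.length
    · have hi' : (i : ℕ) + 1 < u.length + 1 := by omega
      rw [Finset.sum_eq_single (⟨i + 1, hi'⟩ : Fin (u.length + 1)), ih,
        wordShift_get u rfl hi, List.drop_eq_getElem_cons hi]
      · simp only [List.cons.injEq]
        by_cases h1 : u[(i : ℕ)] = a <;> simp [h1]
      · intro m _ hm
        rw [wordShift_band u a (fun h => hm (Fin.ext h)), zero_mul]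
      · simp
    · have hd : u.drop (i : ℕ) = [] := List.drop_eq_nil_of_le (by omega)
      refine (Finset.sum_eq_zero fun m _ => ?_).trans (if_neg (by simp [hd])).symm
      rw [wordShift_band u a (fun h => by have := m.2; omega), zero_mul]

/-! ### Nest representations that annihilate `U` -/

attribute [local instance] Matrix.linftyOpNormedRing Matrix.linftyOpNormedAlgebra

theorem sum_norm_row_le {l : ℕ} (A : Matrix (Fin l) (Fin l) ℂ) (i : Fin l) :
    ∑ j, ‖A i j‖ ≤ ‖A‖ := by
  have h := Finset.le_sup (f := fun i => ∑ j, ‖A i j‖₊) (Finset.mem_univ i)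
  rw [← Matrix.linfty_opNNNorm_def, ← NNReal.coe_le_coe] at h
  simpa using h

theorem norm_le_of_sum_norm_row_le {l : ℕ} {A : Matrix (Fin l) (Fin l) ℂ} {c : ℝ} (hc : 0 ≤ c)
    (h : ∀ i, ∑ j, ‖A i j‖ ≤ c) : ‖A‖ ≤ c := by
  lift c to NNReal using hc
  rw [← coe_nnnorm, NNReal.coe_le_coe, Matrix.linfty_opNNNorm_def]
  exact Finset.sup_le fun i _ => by simpa [← NNReal.coe_le_coe] using h i

/-- A tuple of diagonal matrices whose joint eigenvalues lie in the ball of radius `r`. -/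
theorem norm_transfer_diagonal_le {l : ℕ} {x : Fin l → EuclideanSpace ℂ (Fin n)} {r : ℝ}
    (hr : 0 ≤ r) (hx : ∀ i, ‖x i‖ ≤ r) :
    ‖transfer fun a => Matrix.diagonal fun i => x i a‖ ≤ r := by
  refine norm_transfer_le hr fun h => ?_
  refine norm_le_of_sum_norm_row_le (by positivity) fun i => ?_
  calc ∑ j, ‖(∑ a, Matrix.diagonal (fun i => x i a) * h a) i j‖
      ≤ ∑ j, ∑ a, ‖x i a‖ * ‖h a i j‖ := Finset.sum_le_sum fun j _ => by
        rw [Matrix.sum_apply]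
        refine (norm_sum_le _ _).trans_eq (Finset.sum_congr rfl fun a _ => ?_)
        rw [Matrix.diagonal_mul, norm_mul]
    _ = ∑ a, ‖x i a‖ * ∑ j, ‖h a i j‖ := by
        rw [Finset.sum_comm]
        simp_rw [Finset.mul_sum]
    _ ≤ ∑ a, ‖x i a‖ * ‖h a‖ :=
        Finset.sum_le_sum fun a _ => by gcongr; exact sum_norm_row_le _ _
    _ ≤ √(∑ a, ‖x i a‖ ^ 2) * √(∑ a, ‖h a‖ ^ 2) := Real.sum_mul_le_sqrt_mul_sqrt _ _ _
    _ ≤ r * √(∑ a, ‖h a‖ ^ 2) := by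
        rw [← EuclideanSpace.norm_eq]
        gcongr
        exact hx i

/-- The upper triangular tuple with the points `x i` on the diagonal and `c` times the shift along
the word `u` above it. -/
def bidiagonal (u : List (Fin n)) (x : Fin (u.length + 1) → EuclideanSpace ℂ (Fin n)) (c : ℂ)
    (a : Fin n) : Matrix (Fin (u.length + 1)) (Fin (u.length + 1)) ℂ :=
  Matrix.diagonal (fun i => x i a) + c • wordShift u a

theorem bidiagonal_diag (u : List (Fin n)) (x : Fin (u.length + 1) → EuclideanSpace ℂ (Fin n))
    (c : ℂ) (a : Fin n) (i : Fin (u.length + 1)) : bidiagonal u x c a i i = x i a := by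
  simp [bidiagonal, wordShift_band u a (i := i) (j := i) (by omega)]

theorem bidiagonal_blockTriangular (u : List (Fin n))
    (x : Fin (u.length + 1) → EuclideanSpace ℂ (Fin n)) (c : ℂ) (a : Fin n) :
    (bidiagonal u x c a).BlockTriangular id := by
  intro i j hij
  have h : (j : ℕ) < i := hij
  have : i ≠ j := fun e => by subst e; omega
  simp [bidiagonal, this, wordShift_band u a (i := i) (j := j) (by omega)]

theorem bidiagonal_mul_apply (u : List (Fin n))
    (x : Fin (u.length + 1) → EuclideanSpace ℂ (Fin n)) (c : ℂ) (a b : Fin n)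
    {i j : Fin (u.length + 1)} (hij : (j : ℕ) = i + 1) :
    (bidiagonal u x c a * bidiagonal u x c b) i j =
      c * (x i a * wordShift u b i j + wordShift u a i j * x j b) := by
  have hne : i ≠ j := fun e => by subst e; omega
  have h2 : (wordShift u a * wordShift u b) i j = 0 :=
    band_mul (p := 1) (q := 1) (fun i j h => wordShift_band u a (by omega))
      (fun i j h => wordShift_band u b (by omega)) i j (by omega)
  have h1 : (Matrix.diagonal (fun i => x i a) * Matrix.diagonal fun i => x i b) i j = 0 := by
    simp [hne]
  simp only [bidiagonal, add_mul, mul_add, Matrix.add_apply, h1, smul_mul_assoc, mul_smul_comm,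
    Matrix.smul_apply, h2, Matrix.diagonal_mul, Matrix.mul_diagonal, smul_eq_mul]
  ring

/-- For `n ≥ 2`, a bidiagonal tuple whose diagonal points have pairwise distinct coordinates
generates all upper triangular matrices: if the `k`-th letter is `b`, then for `a ≠ b` the
commutator of the matrices at `a` and `b` is nonzero at `(k, k + 1)`. -/
theorem mem_of_bidiagonal_mem [Nontrivial (Fin n)] {u : List (Fin n)}
    {x : Fin (u.length + 1) → EuclideanSpace ℂ (Fin n)} {c : ℂ} (hc : c ≠ 0)
    (hx : ∀ a, Function.Injective fun i => x i a)
    {E : Subalgebra ℂ (Matrix (Fin (u.length + 1)) (Fin (u.length + 1)) ℂ)}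
    (hE : ∀ a, bidiagonal u x c a ∈ E) {M : Matrix (Fin (u.length + 1)) (Fin (u.length + 1)) ℂ}
    (hM : M.BlockTriangular id) : M ∈ E := by
  obtain ⟨a₀⟩ : Nonempty (Fin n) := inferInstance
  have hT := bidiagonal_blockTriangular u x c
  refine mem_of_blockTriangular (hE a₀) (hT a₀) ?_ (fun i j hij => ?_) hM
  · simpa only [bidiagonal_diag] using hx a₀
  have hi : (i : ℕ) < u.length := by have := j.2; omega
  obtain ⟨a, ha⟩ := exists_ne u[(i : ℕ)]
  set b := u[(i : ℕ)] with hb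
  refine ⟨bidiagonal u x c a * bidiagonal u x c b - bidiagonal u x c b * bidiagonal u x c a,
    E.sub_mem (E.mul_mem (hE a) (hE b)) (E.mul_mem (hE b) (hE a)), fun k m hkm => ?_, ?_⟩
  · rw [Matrix.sub_apply]
    rcases lt_or_ge m k with h | h
    · rw [((hT a).mul (hT b)) h, ((hT b).mul (hT a)) h, sub_zero]
    · obtain rfl : m = k := le_antisymm (Fin.le_def.2 (by omega)) h
      rw [diag_mul_of_upper (hT a) (hT b), diag_mul_of_upper (hT b) (hT a), mul_comm, sub_self]
  · have hne : x i a - x j a ≠ 0 := sub_ne_zero.2 fun e => by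
      have := hx a e
      subst this
      omega
    have h1 : wordShift u b i j = 1 := by rw [wordShift_get u hij hi, if_pos hb.symm]
    have h0 : wordShift u a i j = 0 := by
      rw [wordShift_get u hij hi, if_neg (by rw [← hb]; exact ha.symm)]
    rw [Matrix.sub_apply, bidiagonal_mul_apply u x c a b hij, bidiagonal_mul_apply u x c b a hij,
      h1, h0]
    have : c * (x i a * 1 + 0 * x j b) - c * (x i b * 0 + 1 * x j a) = c * (x i a - x j a) := by
      ring
    rw [this]
    exact mul_ne_zero hc hne

theorem discRep_blockTriangular {u : List (Fin n)}
    {x : Fin (u.length + 1) → EuclideanSpace ℂ (Fin n)} {c : ℂ}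
    (hT : ‖transfer (bidiagonal u x c)‖ < 1) (A : Disc n) :
    (discRep _ hT A).BlockTriangular id := by
  let E : Subalgebra ℂ (Disc n) :=
    { carrier := {A | (discRep _ hT A).BlockTriangular id}
      mul_mem' := fun {A C} hA hC => by
        rw [Set.mem_ofPred_eq, map_mul]
        exact Matrix.BlockTriangular.mul hA hC
      add_mem' := fun {A C} hA hC => by
        rw [Set.mem_ofPred_eq, map_add]
        exact Matrix.BlockTriangular.add hA hC
      algebraMap_mem' := fun c => by
        rw [Set.mem_ofPred_eq, AlgHom.commutes]
        exact Matrix.blockTriangular_diagonal _ }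
  have hE : IsClosed (E : Set (Disc n)) := by
    have : (E : Set (Disc n)) = ⋂ (i) (j) (_ : j < i), {A | discRep _ hT A i j = 0} := by
      ext A
      simp only [Set.mem_iInter]
      exact ⟨fun h i j hij => h hij, fun h i j hij => h i j hij⟩
    rw [this]
    refine isClosed_iInter fun i => isClosed_iInter fun j => isClosed_iInter fun _ =>
      isClosed_eq ?_ continuous_const
    exact (continuous_discRep hT).matrix_elem i j
  have htop := eq_top_of_isClosed_of_generators (D := discSubalgebra n) rfl E hE (by
    rintro A ⟨a, ha⟩
    obtain rfl : A = S a := Subtype.ext ha.symm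
    change (discRep _ hT (S a)).BlockTriangular id
    rw [discRep_S]
    exact bidiagonal_blockTriangular u x c a)
  exact htop.ge (Algebra.mem_top (x := A))

/-- The representation of `𝔄ₙ` given by a bidiagonal tuple, composed with the zeroth Fourier
coefficient, is a nest representation of the semicrossed product. -/
theorem exists_nestRep [Nontrivial (Fin n)] (φ : Disc n ≃ₐ[ℂ] Disc n) {u : List (Fin n)}
    {x : Fin (u.length + 1) → OpenBall n} {c : ℂ} (hc : c ≠ 0)
    (hx : ∀ a, Function.Injective fun i => (x i : EuclideanSpace ℂ (Fin n)) a)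
    (hT : ‖transfer (bidiagonal u (fun i => x i) c)‖ < 1) :
    ∃ ρ ∈ nestFamily φ x, ∀ X, ρ.toAlgHom X = discRep _ hT (constTerm φ X) := by
  refine ⟨⟨(discRep _ hT).comp (constTerm φ),
    (continuous_discRep hT).comp (continuous_constTerm φ), ?_⟩, fun i => ?_, fun _ => rfl⟩
  · ext M
    refine ⟨?_, fun hM => ?_⟩
    · rintro ⟨X, rfl⟩
      exact discRep_blockTriangular hT _
    · obtain ⟨A, hA⟩ := mem_of_bidiagonal_mem hc hx (E := (discRep _ hT).range)
        (fun a => ⟨S a, discRep_S hT a⟩) hM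
      exact ⟨incl φ A, hA⟩
  · refine Prod.ext ?_ ?_
    · ext a
      change discRep _ hT (S a) i i = _
      rw [discRep_S, bidiagonal_diag]
    · change discRep _ hT (constTerm φ (U φ)) i i = 0
      rw [constTerm_U, map_zero, Matrix.zero_apply]

/-! ### Elements of `ℑ_Z` have vanishing zeroth Fourier coefficient -/

open Filter Topology in
/-- Any finite family in the ball can be moved slightly to have distinct coordinates. -/
theorem exists_near_injective {l : ℕ} (x : Fin l → OpenBall n) {ε : ℝ} (hε : 0 < ε) :
    ∃ y : Fin l → OpenBall n,
      (∀ i, ‖(x i : EuclideanSpace ℂ (Fin n)) - y i‖ < ε) ∧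
      ∀ a, Function.Injective fun i => (y i : EuclideanSpace ℂ (Fin n)) a := by
  let y : ℂ → Fin l → EuclideanSpace ℂ (Fin n) := fun s i =>
    (x i : EuclideanSpace ℂ (Fin n)) + s • WithLp.toLp 2 fun _ => ((i : ℕ) : ℂ)
  have hy : ∀ i, Continuous fun s => y s i := fun i => by fun_prop
  have hy0 : ∀ i, y 0 i = x i := fun i => by simp [y]
  have h1 : ∀ᶠ s in 𝓝[≠] (0 : ℂ), ∀ i, y s i ∈ Metric.ball (0 : EuclideanSpace ℂ (Fin n)) 1 := by
    refine nhdsWithin_le_nhds (eventually_all.2 fun i => ?_)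
    exact (hy i).continuousAt.eventually_mem
      (Metric.isOpen_ball.mem_nhds (by rw [hy0]; exact (x i).2))
  have h2 : ∀ᶠ s in 𝓝[≠] (0 : ℂ), ∀ i, ‖(x i : EuclideanSpace ℂ (Fin n)) - y s i‖ < ε := by
    refine nhdsWithin_le_nhds (eventually_all.2 fun i => ?_)
    have hc : ContinuousAt (fun s => ‖(x i : EuclideanSpace ℂ (Fin n)) - y s i‖) 0 :=
      (continuous_const.sub (hy i)).norm.continuousAt
    exact hc.eventually_lt continuousAt_const (by simpa [hy0] using hε)
  have h3 : ∀ᶠ s in 𝓝[≠] (0 : ℂ), ∀ a i j, i ≠ j → y s i a ≠ y s j a := by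
    refine eventually_all.2 fun a => eventually_all.2 fun i => eventually_all.2 fun j => ?_
    by_cases hij : i = j
    · exact Eventually.of_forall fun s h => absurd hij h
    by_cases hx : (x i : EuclideanSpace ℂ (Fin n)) a = (x j : EuclideanSpace ℂ (Fin n)) a
    · filter_upwards [self_mem_nhdsWithin] with s hs _ h
      have hs : s ≠ 0 := hs
      simp only [y, PiLp.add_apply, PiLp.smul_apply, hx, smul_eq_mul, add_right_inj] at h
      exact hij (Fin.ext (by exact_mod_cast mul_left_cancel₀ hs h))
    · have hc : ∀ i, ContinuousAt (fun s => y s i a) 0 := fun i => by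
        have := hy i
        fun_prop
      have := ((hc i).sub (hc j)).eventually_ne (y := 0) (by simpa [hy0, sub_ne_zero] using hx)
      exact nhdsWithin_le_nhds (this.mono fun s hs _ => sub_ne_zero.1 hs)
  obtain ⟨s, hs1, hs2, hs3⟩ := (h1.and (h2.and h3)).exists
  exact ⟨fun i => ⟨y s i, hs1 i⟩, hs2, fun a i j h => by_contra fun hij => hs3 a i j hij h⟩

theorem lift_smul_wordShift (u : List (Fin n)) (c : ℂ) (w : FreeMonoid (Fin n)) :
    FreeMonoid.lift (c • wordShift u) w = c ^ w.length • FreeMonoid.lift (wordShift u) w := by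
  induction w using FreeMonoid.inductionOn' with
  | one => simp
  | of_mul a w ih =>
    rw [map_mul, map_mul, ih, FreeMonoid.lift_eval_of, FreeMonoid.lift_eval_of, Pi.smul_apply,
      smul_mul_smul_comm, FreeMonoid.length_mul, FreeMonoid.length_of, pow_add, pow_one]

open Classical in
theorem symbolMap_entry_eq {l : ℕ} {T : Fin n → Matrix (Fin l) (Fin l) ℂ} (hT : ‖transfer T‖ < 1)
    {i j : Fin l} {w₀ : FreeMonoid (Fin n)} {k : ℂ}
    (h : ∀ w, FreeMonoid.lift T w i j = if w = w₀ then k else 0) (v : Fock n) :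
    symbolMap T v i j = k * v w₀ := by
  have heq : (⟨(Matrix.entryLinearMap ℂ ℂ i j).comp (symbolMap T).toLinearMap,
      (symbolMap T).continuous.matrix_elem i j⟩ : Fock n →L[ℂ] ℂ) =
      k • innerSL ℂ (ξ w₀) := by
    refine clm_ext_ξ fun w => ?_
    change symbolMap T (ξ w) i j = k * inner ℂ (ξ w₀) (ξ w)
    rw [symbolMap_ξ hT, h, inner_ξ_left, ξ_apply]
    by_cases hw : w = w₀
    · simp [hw]
    · simp [hw, Ne.symm hw]
  have := congrArg (fun f => f v) heq
  change symbolMap T v i j = k * inner ℂ (ξ w₀) v at this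
  rwa [inner_ξ_left] at this

/-- At a multiple of the shift along `u`, the entries `(0, 0)` and `(0, length u)` of `symbolMap`
read off the coefficients at the empty word and at `u`. -/
theorem symbolMap_wordShift_eq_zero {u : List (Fin n)} {c : ℂ}
    (hT : ‖transfer (c • wordShift u)‖ < 1) (hc : c ≠ 0) {v : Fock n}
    (h : symbolMap (c • wordShift u) v = 0) : v 1 = 0 ∧ v (FreeMonoid.ofList u) = 0 := by
  classical
  constructor
  · have := symbolMap_entry_eq hT (i := 0) (j := 0) (w₀ := 1) (k := 1) (fun w => by
      rw [lift_smul_wordShift, Matrix.smul_apply, lift_wordShift]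
      have hiff : List.drop (((0 : Fin (u.length + 1)) : ℕ)) u =
          FreeMonoid.toList w ++ List.drop (((0 : Fin (u.length + 1)) : ℕ)) u ↔ w = 1 := by
        rw [List.self_eq_append_left]
        exact Iff.rfl
      by_cases hw : w = 1
      · rw [if_pos (hiff.2 hw), if_pos hw, hw]
        simp
      · rw [if_neg (hiff.not.2 hw), if_neg hw, smul_zero]) v
    rw [h, one_mul] at this
    exact this.symm
  · have := symbolMap_entry_eq hT (i := 0) (j := Fin.last _) (w₀ := FreeMonoid.ofList u)
      (k := c ^ u.length) (fun w => by
      rw [lift_smul_wordShift, Matrix.smul_apply, lift_wordShift]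
      have hiff : List.drop (((0 : Fin (u.length + 1)) : ℕ)) u =
          FreeMonoid.toList w ++ List.drop ((Fin.last u.length : Fin (u.length + 1)) : ℕ) u ↔
          w = FreeMonoid.ofList u := by
        rw [Fin.val_last, List.drop_length, List.append_nil]
        exact eq_comm
      by_cases hw : w = FreeMonoid.ofList u
      · rw [if_pos (hiff.2 hw), if_pos hw, hw]
        simp [FreeMonoid.length]
      · rw [if_neg (hiff.not.2 hw), if_neg hw, smul_zero]) v
    rw [h] at this
    exact (mul_eq_zero.1 this.symm).resolve_left (pow_ne_zero _ hc)

theorem transfer_bidiagonal_smul (u : List (Fin n))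
    (x : Fin (u.length + 1) → EuclideanSpace ℂ (Fin n)) (c t : ℂ) :
    transfer (bidiagonal u (fun i => t • x i) c) =
      t • transfer (fun a => Matrix.diagonal fun i => x i a) + c • transfer (wordShift u) := by
  rw [← transfer_smul, ← transfer_smul, ← transfer_add]
  congr 1
  funext a
  simp only [bidiagonal, Pi.add_apply, Pi.smul_apply, PiLp.smul_apply, ← Matrix.diagonal_smul]
  rfl

open Filter Topology in
/-- Move the diagonal `Z` slightly to points `y` with distinct coordinates, and consider the
bidiagonal tuples with diagonal `t y`. For `t` near `1` they define nest representations with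
diagonal near `Z`, so `X` is mapped to `0`; by the identity theorem the same holds at `t = 0`, where
the representation reads off coefficients. -/
theorem coeff_constTerm_eq_zero [Nontrivial (Fin n)] {φ : Disc n ≃ₐ[ℂ] Disc n}
    {Z : ℕ → OpenBall n} {X : Semicrossed φ} (hX : X ∈ idealI φ Z) {u : List (Fin n)}
    (hu : u ≠ []) {v : Fock n} (hv : v = (constTerm φ X : Fock n →L[ℂ] Fock n) (ξ 1)) :
    v 1 = 0 ∧ v (FreeMonoid.ofList u) = 0 := by
  rw [← SetLike.mem_coe, coe_idealI] at hX
  have hl : 2 ≤ u.length + 1 := by have := List.length_pos_iff.2 hu; omega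
  obtain ⟨ε, hε, hker⟩ := mem_idealISet.1 hX (u.length + 1) hl
  obtain ⟨y, hyZ, hyinj⟩ := exists_near_injective
    (fun i : Fin (u.length + 1) => Z i) (half_pos hε)
  obtain ⟨i₀, hi₀⟩ := Finite.exists_max fun i => ‖(y i : EuclideanSpace ℂ (Fin n))‖
  set r : ℝ := ‖(y i₀ : EuclideanSpace ℂ (Fin n))‖ with hr
  have hr0 : 0 ≤ r := norm_nonneg _
  have hr1 : r < 1 := mem_ball_zero_iff.1 (y i₀).2
  -- The weight `c` of the shift leaves room for `t` in a disc of radius `1 + δ > 1`.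
  set k : ℝ := ‖transfer (wordShift u)‖ with hk
  have hk0 : 0 ≤ k := norm_nonneg _
  set δ : ℝ := (1 - r) / 3 with hδ
  have hδ0 : 0 < δ := by rw [hδ]; linarith
  set c : ℂ := ((δ / (k + 1) : ℝ) : ℂ) with hc
  have hc0 : c ≠ 0 := Complex.ofReal_ne_zero.2 (by positivity)
  have hck : ‖c‖ * k ≤ δ := by
    rw [hc, Complex.norm_real, Real.norm_of_nonneg (by positivity), div_mul_eq_mul_div]
    exact (div_le_iff₀ (by positivity)).2 (by nlinarith)
  let T : ℂ → Fin n → Matrix (Fin (u.length + 1)) (Fin (u.length + 1)) ℂ := fun t =>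
    bidiagonal u (fun i => t • (y i : EuclideanSpace ℂ (Fin n))) c
  have hT : ∀ t ∈ Metric.ball (0 : ℂ) (1 + δ), ‖transfer (T t)‖ < 1 := fun t ht => by
    have ht : ‖t‖ < 1 + δ := mem_ball_zero_iff.1 ht
    have hD : ‖transfer fun a => Matrix.diagonal fun i => (y i : EuclideanSpace ℂ (Fin n)) a‖ ≤ r :=
      norm_transfer_diagonal_le hr0 hi₀
    rw [transfer_bidiagonal_smul]
    calc _ ≤ ‖t‖ * r + ‖c‖ * k := by
          refine (norm_add_le _ _).trans (add_le_add ?_ (norm_smul_le _ _))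
          exact (norm_smul_le _ _).trans (by gcongr)
      _ ≤ (1 + δ) * r + δ := by gcongr
      _ < 1 := by nlinarith
  let f : ℂ → Matrix (Fin (u.length + 1)) (Fin (u.length + 1)) ℂ := fun t => symbolMap (T t) v
  have hf : DifferentiableOn ℂ f (Metric.ball 0 (1 + δ)) := fun t ht => by
    refine (differentiableAt_symbolMap ?_ (hT t ht) v).differentiableWithinAt
    simp only [T, transfer_bidiagonal_smul]
    fun_prop
  have h1 : (1 : ℂ) ∈ Metric.ball (0 : ℂ) (1 + δ) := by simp [hδ0]
  have h0 : (0 : ℂ) ∈ Metric.ball (0 : ℂ) (1 + δ) := by simp; linarith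
  have hnear : f =ᶠ[𝓝 1] 0 := by
    have e1 : ∀ᶠ t : ℂ in 𝓝 1, ∀ i, t • (y i : EuclideanSpace ℂ (Fin n)) ∈
        Metric.ball (0 : EuclideanSpace ℂ (Fin n)) 1 := eventually_all.2 fun i => by
      have hcont : ContinuousAt (fun t : ℂ => t • (y i : EuclideanSpace ℂ (Fin n))) 1 := by
        fun_prop
      exact hcont.eventually_mem (Metric.isOpen_ball.mem_nhds (by rw [one_smul]; exact (y i).2))
    have e2 : ∀ᶠ t : ℂ in 𝓝 1, ∀ i : Fin (u.length + 1),
        ‖(Z i : EuclideanSpace ℂ (Fin n)) - t • (y i : EuclideanSpace ℂ (Fin n))‖ < ε / 2 :=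
      eventually_all.2 fun i => by
        have hcont : ContinuousAt (fun t : ℂ =>
            ‖(Z i : EuclideanSpace ℂ (Fin n)) - t • (y i : EuclideanSpace ℂ (Fin n))‖) 1 := by
          fun_prop
        exact hcont.eventually_lt continuousAt_const (by rw [one_smul]; exact hyZ i)
    filter_upwards [e1, e2, Metric.isOpen_ball.mem_nhds h1,
      isOpen_ne.mem_nhds (one_ne_zero : (1 : ℂ) ≠ 0)] with t ht1 ht2 ht3 ht4
    obtain ⟨ρ, hρ, hρX⟩ := exists_nestRep φ (u := u)
      (x := fun i => ⟨t • (y i : EuclideanSpace ℂ (Fin n)), ht1 i⟩) hc0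
      (fun a i j hij => hyinj a (mul_left_cancel₀ ht4 hij)) (hT t ht3)
    have hdist : seqDist Z (fun i : Fin (u.length + 1) =>
        (⟨t • (y i : EuclideanSpace ℂ (Fin n)), ht1 i⟩ : OpenBall n)) < ε :=
      (ciSup_le fun i => (ht2 i).le).trans_lt (half_lt_self hε)
    have hz := (TwoSidedIdeal.mem_ker _).1 (hker _ hdist ρ hρ)
    rw [hρX, discRep_apply, ← hv] at hz
    exact hz
  have hzero := (hf.analyticOnNhd Metric.isOpen_ball).eqOn_zero_of_preconnected_of_eventuallyEq_zero
    (convex_ball _ _).isPreconnected h1 hnear h0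
  have hT0 : T 0 = c • wordShift u := by
    funext a
    simp [T, bidiagonal]
  have hT1 := hT 0 h0
  rw [hT0] at hT1
  refine symbolMap_wordShift_eq_zero hT1 hc0 ?_
  rw [← hT0]
  exact hzero

theorem constTerm_ξ_one_eq_zero [Nontrivial (Fin n)] {φ : Disc n ≃ₐ[ℂ] Disc n}
    {Z : ℕ → OpenBall n} {X : Semicrossed φ} (hX : X ∈ idealI φ Z) :
    (constTerm φ X : Fock n →L[ℂ] Fock n) (ξ 1) = 0 := by
  obtain ⟨a⟩ : Nonempty (Fin n) := inferInstance
  ext w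
  by_cases hw : FreeMonoid.toList w = []
  · obtain rfl : w = 1 := hw
    exact (coeff_constTerm_eq_zero hX (List.cons_ne_nil a []) rfl).1
  · exact (coeff_constTerm_eq_zero hX hw rfl).2

theorem idealI_le_idealJ [Nontrivial (Fin n)] (φ : Disc n ≃ₐ[ℂ] Disc n) (Z : ℕ → OpenBall n) :
    idealI φ Z ≤ idealJ φ := by
  intro X hX
  refine mem_idealJ_of_constTerm_eq_zero (Subtype.ext (clm_ext_ξ fun w => ?_))
  -- `ℑ_Z` is a right ideal, so the coefficients of `E₀(X) S_w` vanish for every word `w`.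
  have hw : ∃ A : Disc n, (A : Fock n →L[ℂ] Fock n) (ξ 1) = ξ w := by
    induction w using FreeMonoid.inductionOn' with
    | one => exact ⟨1, rfl⟩
    | of_mul a w ih =>
      obtain ⟨A, hA⟩ := ih
      refine ⟨S a * A, ?_⟩
      change creation a ((A : Fock n →L[ℂ] Fock n) (ξ 1)) = _
      rw [hA, creation_ξ]
  obtain ⟨A, hA⟩ := hw
  have h := constTerm_ξ_one_eq_zero ((idealI φ Z).mul_mem_right X (incl φ A) hX)
  rw [map_mul, constTerm_incl] at h
  change (constTerm φ X : Fock n →L[ℂ] Fock n) ((A : Fock n →L[ℂ] Fock n) (ξ 1)) = 0 at h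
  rw [hA] at h
  simpa using h

end NCDisc

end

theorem theorem4p4 (n : ℕ) (hn : 2 ≤ n) (φ : NCDisc.Disc n ≃ₐ[ℂ] NCDisc.Disc n)
    (hφ : Isometry φ) :
    (∀ Z : ℕ → NCDisc.OpenBall n, NCDisc.idealI φ Z ≤ NCDisc.idealJ φ) ∧
    (∀ Z : ℕ → NCDisc.OpenBall n,
      NCDisc.hat φ '' NCDisc.charSet Z ∩ NCDisc.charSet Z = ∅ →
        NCDisc.idealI φ Z = NCDisc.idealJ φ) ∧
    (NCDisc.idealJ φ : Set (NCDisc.Semicrossed φ)) =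
      ⋃ Z : ℕ → NCDisc.OpenBall n, (NCDisc.idealI φ Z : Set (NCDisc.Semicrossed φ)) := by
  have : Nontrivial (Fin n) := Fin.nontrivial_iff_two_le.2 hn
  have hle := NCDisc.idealI_le_idealJ φ
  refine ⟨hle, fun Z hZ => le_antisymm (hle Z) (NCDisc.idealJ_le_idealI fun i j _ h => ?_), ?_⟩
  · exact hZ.le ⟨⟨_, ⟨j, NCDisc.charPoint_pointChar (Z j)⟩, rfl⟩, ⟨i, h⟩⟩
  · obtain ⟨Z, hZ⟩ := NCDisc.exists_seq_charPoint_hat_ne φ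
    exact Set.Subset.antisymm
      (fun X hX => Set.mem_iUnion.2 ⟨Z, NCDisc.idealJ_le_idealI hZ hX⟩)
      (Set.iUnion_subset fun Z => hle Z)
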